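/- \textbf{Arithmetic model.} Programs act on real scalars by loading constants, by $+,-,\times,/$ and $\sqrt{\cdot}$, and by comparisons. In floating-point arithmetic with machine epsilon $\varepsilon$, each arithmetic operation and each square root returns some number with relative error at most $\varepsilon$ (i.e. $\mathrm{fl}(x\ \mathrm{op}\ y)=(x\ \mathrm{op}\ y)(1+\delta)$ with $|\delta|\le\varepsilon$, where $\delta$ may differ from operation to operation); comparisons and constants are exact. Arithmetic operations, square roots and comparisons count as one operation each. Statements about executions hold for all possible roundings. $\|\cdot\|$ is the spectral norm. \textbf{Matrix multiplication.} Let $MM$ be a routine that consists, for every $k\ge1$, of a program taking two $k\times k$ matrices to a $k\times k$ matrix. Products of $p\times q$ by $q\times r$ matrices are computed by cutting both factors into $k\times k$ blocks, $k=\min(p,q,r)$ (zero-padded at the border), multiplying the blocks by $MM$ and summing. \textbf{Algorithm.} For an $n\times m$ matrix $A$ with $n\ge m$, $[R,W,Y]=QRR(A)$ is computed recursively, with $l=\lfloor m/2\rfloor$: If $m=1$: compute $\sigma\approx\|A\|$ (square root of the sum of squares). If $\sigma>0$, put $R=\sigma$ if $A_1<0$ and $R=-\sigma$ otherwise, $v=A-R\,e_1$,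 and return $R$, $W=v/\|v\|_2$, $Y=2W^T$ (Householder transformation $I-WY$); if $\sigma=0$, return $R=0$, $W=e_1$, $Y=2e_1^T$. If $m\ge2$: $[R_L,W_L,Y_L]=QRR(A(:,1:l))$; $A_R=A(:,l+1:m)-W_L(Y_L\,A(:,l+1:m))$; $[R_R,W_R,Y_R]=QRR(A_R(l+1:n,:))$; $X=W_L-[0;\,W_R(Y_R\,W_L(l+1:n,:))]$ (the first $l$ rows of $W_L$ being copied); return $$R=\begin{bmatrix}R_L&A_R(1:l,:)\\0&R_R\end{bmatrix},\qquad W=\begin{bmatrix}X,&\begin{bmatrix}0\\W_R\end{bmatrix}\end{bmatrix},\qquad Y=\begin{bmatrix}Y_L\\ [\,0,\ Y_R\,]\end{bmatrix}.$$ (For $m=0$ the outputs are empty matrices.) \textbf{Theorem.} Let $MM$ be such a routine. (1) Let $\gamma>2$ and suppose that there is $C$ such that, for all $k\ge1$, $0\le\varepsilon<1$, every execution of $MM$ on two $k\times k$ matrices takes at most $Ck^\gamma$ operations. Then there is $C'$ such that, for all $n\ge m$, $0\le\varepsilon<1$ and every $n\times m$ real matrix $A$, every execution of $QRR(A)$ takes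 at most $C'\,n\,m^{\gamma-1}$ operations. (2) Suppose that $MM$ satisfies the normwise error bound $$\|P_{comp}-AB\|\le\mu(k)\,\varepsilon\,\|A\|\,\|B\|+O(\varepsilon^2)\,\|A\|\,\|B\|,\qquad \mu(k)=O(k^{d})\text{ for some constant } d,$$ for the computed product $P_{comp}$ of any two $k\times k$ matrices $A,B$; here $O(\varepsilon^2)$ is as $\varepsilon\to0$ for fixed $k$, uniformly in $A$, $B$ and the roundings. Then there are constants $K,c$ such that for all $n\ge m$ there is $\varepsilon_0>0$ such that, for all $0<\varepsilon\le\varepsilon_0$, every $n\times m$ real matrix $A$ and every possible computed output $[R,W,Y]$ of $QRR(A)$: $R$ is upper triangular, and there are matrices $\delta Q^T$ ($n\times n$) and $\delta A$ ($n\times m$) such that $Q^T=I-WY+\delta Q^T$ is exactly orthogonal, $$(I-WY+\delta Q^T)(A+\delta A)=\begin{bmatrix}R\\0\end{bmatrix},\qquad \|\delta Q^T\|\le K n^{c}\,\varepsilon,\qquad \|\delta A\|\le K n^{c}\,\varepsilon\,\|A\|.$$ -/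

import Mathlib

open scoped Matrix.Norms.L2Operator

/-! ### Arithmetic programs and their floating-point executions -/

/-- The four binary arithmetic operations. -/
inductive ArithOp
  | add | sub | mul | div

/-- The exact value of a binary arithmetic operation. -/
noncomputable def ArithOp.eval : ArithOp → ℝ → ℝ → ℝ
  | .add, x, y => x + y
  | .sub, x, y => x - y
  | .mul, x, y => x * y
  | .div, x, y => x / y

/-- Arithmetic programs that return a value of type `α`. The scalars that a program handles belong to
an abstract type `V`: a program which is defined for an arbitrary `V` can only create scalars by
loading constants or by arithmetic operations and square roots, and can only inspect them by
comparisons. -/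
inductive Prog (V : Type) (α : Type) : Type
  | ret (a : α)
  | const (c : ℝ) (k : V → Prog V α)
  | arith (o : ArithOp) (x y : V) (k : V → Prog V α)
  | sqrt (x : V) (k : V → Prog V α)
  | less (x y : V) (k : Bool → Prog V α)

namespace Prog

variable {V α β : Type}

/-- Sequential composition of programs. -/
def bind : Prog V α → (α → Prog V β) → Prog V β
  | ret a, f => f a
  | const c k, f => const c fun z => (k z).bind f
  | arith o x y k, f => arith o x y fun z => (k z).bind f
  | sqrt x k, f => sqrt x fun z => (k z).bind f
  | less x y k, f => less x y fun b => (k b).bind f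

instance : Monad (Prog V) where
  pure := ret
  bind := bind

/-- `p.Exec ε a t`: an execution of `p` in floating-point arithmetic with machine epsilon `ε` can
return `a` after `t` operations. Every arithmetic operation and every square root returns some number
whose relative error is at most `ε`, that is, `fl (x op y) = (x op y) * (1 + δ)` with `|δ| ≤ ε`, where
`δ` may be different each time; comparisons and constants are exact. Arithmetic operations, square
roots and comparisons count as one operation each. -/
noncomputable def Exec (ε : ℝ) : Prog ℝ α → α → ℕ → Prop
  | ret a, b, t => b = a ∧ t = 0
  | const c k, b, t => (k c).Exec ε b t
  | arith o x y k, b, t =>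
      ∃ z s, |z - o.eval x y| ≤ ε * |o.eval x y| ∧ (k z).Exec ε b s ∧ t = s + 1
  | sqrt x k, b, t =>
      ∃ z s, |z - Real.sqrt x| ≤ ε * |Real.sqrt x| ∧ (k z).Exec ε b s ∧ t = s + 1
  | less x y k, b, t =>
      open Classical in ∃ s, (k (decide (x < y))).Exec ε b s ∧ t = s + 1

/-- Load a constant. -/
def literal (c : ℝ) : Prog V V := const c ret

/-- Floating-point addition. -/
def fadd (x y : V) : Prog V V := arith .add x y ret

/-- Floating-point subtraction. -/
def fsub (x y : V) : Prog V V := arith .sub x y ret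

/-- Floating-point multiplication. -/
def fmul (x y : V) : Prog V V := arith .mul x y ret

/-- Floating-point division. -/
def fdiv (x y : V) : Prog V V := arith .div x y ret

/-- Floating-point square root. -/
def fsqrt (x : V) : Prog V V := sqrt x ret

/-- Comparison of two scalars. -/
def isLess (x y : V) : Prog V Bool := less x y ret

/-- Run the programs `f 0, …, f (n - 1)` one after the other and collect their results. -/
def tabulate : {n : ℕ} → (Fin n → Prog V α) → Prog V (Fin n → α)
  | 0, _ => pure Fin.elim0
  | _ + 1, f => do
      let a ← f 0
      let g ← tabulate fun i => f i.succ
      pure (Fin.cons a g)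

end Prog

/-! ### Submatrices and block matrices -/

section Blocks

variable {V : Type} {n m a : ℕ}

/-- The index `a + j`, for `j < n - a`. -/
def upperIdx (h : a ≤ n) (j : Fin (n - a)) : Fin n := ⟨a + j, by omega⟩

/-- The first `a` columns, `A(:, 1:a)`. -/
def leftCols (h : a ≤ m) (A : Matrix (Fin n) (Fin m) V) : Matrix (Fin n) (Fin a) V :=
  A.submatrix id (Fin.castLE h)

/-- The columns after the first `a` ones, `A(:, a+1:m)`. -/
def rightCols (h : a ≤ m) (A : Matrix (Fin n) (Fin m) V) : Matrix (Fin n) (Fin (m - a)) V :=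
  A.submatrix id (upperIdx h)

/-- The first `a` rows, `A(1:a, :)`. -/
def topRows (h : a ≤ n) (A : Matrix (Fin n) (Fin m) V) : Matrix (Fin a) (Fin m) V :=
  A.submatrix (Fin.castLE h) id

/-- The rows after the first `a` ones, `A(a+1:n, :)`. -/
def bottomRows (h : a ≤ n) (A : Matrix (Fin n) (Fin m) V) : Matrix (Fin (n - a)) (Fin m) V :=
  A.submatrix (upperIdx h) id

/-- Concatenation of a family of length `a` and a family of length `n - a`. -/
def glue {α : Type} (f : Fin a → α) (g : Fin (n - a) → α) : Fin n → α :=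
  fun i => if hi : i.val < a then f ⟨i, hi⟩ else g ⟨i - a, by omega⟩

/-- The block matrix `[A; B]`. -/
def vcat (A : Matrix (Fin a) (Fin m) V) (B : Matrix (Fin (n - a)) (Fin m) V) :
    Matrix (Fin n) (Fin m) V :=
  Matrix.of fun i j => glue (fun i' => A i' j) (fun i' => B i' j) i

/-- The block matrix `[A, B]`. -/
def hcat (A : Matrix (Fin n) (Fin a) V) (B : Matrix (Fin n) (Fin (m - a)) V) :
    Matrix (Fin n) (Fin m) V :=
  Matrix.of fun i j => glue (A i) (B i) j

/-- The matrix all of whose entries are the scalar `z`. -/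
def constMat (n m : ℕ) (z : V) : Matrix (Fin n) (Fin m) V := Matrix.of fun _ _ => z

end Blocks

/-! ### Matrix operations -/

/-- Entrywise addition of matrices. -/
def matAdd {V : Type} {n m : ℕ} (A B : Matrix (Fin n) (Fin m) V) :
    Prog V (Matrix (Fin n) (Fin m) V) :=
  Prog.tabulate fun i => Prog.tabulate fun j => Prog.fadd (A i j) (B i j)

/-- Entrywise subtraction of matrices. -/
def matSub {V : Type} {n m : ℕ} (A B : Matrix (Fin n) (Fin m) V) :
    Prog V (Matrix (Fin n) (Fin m) V) :=
  Prog.tabulate fun i => Prog.tabulate fun j => Prog.fsub (A i j) (B i j)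

/-- A routine for the multiplication of square matrices: for every `k`, a program that takes two
`k`-by-`k` matrices and returns a `k`-by-`k` matrix. -/
def MatMul : Type 1 :=
  ∀ (V : Type) (k : ℕ), Matrix (Fin k) (Fin k) V → Matrix (Fin k) (Fin k) V →
    Prog V (Matrix (Fin k) (Fin k) V)

/-- The routine multiplies `k`-by-`k` matrices in `O(k ^ γ)` operations. -/
def MatMul.HasCost (mm : MatMul) (γ : ℝ) : Prop :=
  ∃ C : ℝ, ∀ k : ℕ, 1 ≤ k → ∀ ε : ℝ, 0 ≤ ε → ε < 1 →
    ∀ (A B P : Matrix (Fin k) (Fin k) ℝ) (t : ℕ),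
      (mm ℝ k A B).Exec ε P t → (t : ℝ) ≤ C * (k : ℝ) ^ γ

/-- The normwise error bound `‖P - A * B‖ ≤ μ(k) ε ‖A‖ ‖B‖ + O(ε ^ 2)` for the computed product `P` of
two `k`-by-`k` matrices, in the spectral norm. Here `μ(k) = O(k ^ c)`, and the term `O(ε ^ 2)`, which
refers to `ε → 0` for fixed `k`, is relative to `‖A‖ ‖B‖`. -/
def MatMul.IsStable (mm : MatMul) : Prop :=
  ∃ (M : ℝ) (c : ℕ), ∀ k : ℕ, 1 ≤ k → ∃ (L : ℝ) (ε₁ : ℝ), 0 < ε₁ ∧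
    ∀ ε : ℝ, 0 < ε → ε ≤ ε₁ → ∀ (A B P : Matrix (Fin k) (Fin k) ℝ) (t : ℕ),
      (mm ℝ k A B).Exec ε P t →
        ‖P - A * B‖ ≤ M * (k : ℝ) ^ c * ε * ‖A‖ * ‖B‖ + L * ε ^ 2 * ‖A‖ * ‖B‖

/-- The `(I, J)` block of size `k`-by-`k` of a matrix, filled up with the scalar `zero` where it
sticks out of the matrix. -/
def paddedBlock {V : Type} {p q : ℕ} (k : ℕ) (zero : V) (A : Matrix (Fin p) (Fin q) V) (I J : ℕ) :
    Matrix (Fin k) (Fin k) V :=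
  Matrix.of fun i j =>
    if h : I * k + i < p ∧ J * k + j < q then A ⟨I * k + i, h.1⟩ ⟨J * k + j, h.2⟩ else zero

theorem div_lt_ceilDiv {k p i : ℕ} (hk : 0 < k) (hi : i < p) : i / k < (p + k - 1) / k := by
  rw [Nat.div_lt_iff_lt_mul hk]
  have h := Nat.div_add_mod (p + k - 1) k
  have h' := Nat.mod_lt (p + k - 1) hk
  rw [Nat.mul_comm] at h
  omega

/-- Multiplication of a `p`-by-`q` and a `q`-by-`r` matrix. With `k = min p q r`, both matrices are cut
into `k`-by-`k` blocks, the blocks are multiplied by the routine `mm`, and the products are summed. -/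
def rectMul (mm : MatMul) {V : Type} {p q r : ℕ} (A : Matrix (Fin p) (Fin q) V)
    (B : Matrix (Fin q) (Fin r) V) : Prog V (Matrix (Fin p) (Fin r) V) := do
  let zero ← Prog.literal 0
  if hk : 0 < min p (min q r) then
    let k := min p (min q r)
    let S : Fin ((p + k - 1) / k) → Fin ((r + k - 1) / k) → Matrix (Fin k) (Fin k) V ←
      Prog.tabulate fun I => Prog.tabulate fun J =>
        (List.range ((q + k - 1) / k)).foldlM (init := constMat k k zero) fun acc K => do
          let P ← mm V k (paddedBlock k zero A I K) (paddedBlock k zero B K J)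
          matAdd acc P
    pure (Matrix.of fun i j =>
      S ⟨i / k, div_lt_ceilDiv hk i.isLt⟩ ⟨j / k, div_lt_ceilDiv hk j.isLt⟩
        ⟨i % k, Nat.mod_lt _ hk⟩ ⟨j % k, Nat.mod_lt _ hk⟩)
  else
    pure (constMat p r zero)

/-! ### Recursive QR decomposition -/

/-- The Euclidean length of a vector. -/
def vecLength {V : Type} {n : ℕ} (x : Fin n → V) : Prog V V := do
  let zero ← Prog.literal 0
  let s ← (List.finRange n).foldlM (init := zero) fun acc i => do
    let p ← Prog.fmul (x i) (x i)
    Prog.fadd acc p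
  Prog.fsqrt s

/-- The Householder transformation `I - w y` that maps the vector `x` to `ρ e₁`, with `ρ = ± ‖x‖`,
`‖w‖ = 1`, `y = 2 wᵀ`. The vector `w` is `v / ‖v‖` with `v = x + sign(x₁) ‖x‖ e₁`, and `w = e₁` if
`x = 0`. The program returns `(ρ, w, y)`. -/
def householder {V : Type} {n : ℕ} (hn : 0 < n) (x : Fin n → V) :
    Prog V (V × (Fin n → V) × (Fin n → V)) := do
  let zero ← Prog.literal 0
  let one ← Prog.literal 1
  let two ← Prog.literal 2
  let first : Fin n := ⟨0, hn⟩
  let σ ← vecLength x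
  let nonzero ← Prog.isLess zero σ
  if nonzero then
    let negative ← Prog.isLess (x first) zero
    let ρ ← if negative then pure σ else Prog.fsub zero σ
    let v₁ ← Prog.fsub (x first) ρ
    let v : Fin n → V := fun i => if i = first then v₁ else x i
    let τ ← vecLength v
    let w ← Prog.tabulate fun i => Prog.fdiv (v i) τ
    let y ← Prog.tabulate fun i => Prog.fmul two (w i)
    pure (ρ, w, y)
  else
    pure (zero, (fun i => if i = first then one else zero),
      (fun i => if i = first then two else zero))

/-- The recursive QR decomposition of an `n`-by-`m` matrix `A` with `m ≤ n`, based on the routine `mm`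
for matrix multiplication. It returns `(R, W, Y)` where `R` is `m`-by-`m`, `W` is `n`-by-`m` and
`Y` is `m`-by-`n`; in exact arithmetic, `I - W Y` is orthogonal and `(I - W Y) A = [R; 0]`. -/
def qrr (mm : MatMul) {V : Type} : (n m : ℕ) → m ≤ n → Matrix (Fin n) (Fin m) V →
    Prog V (Matrix (Fin m) (Fin m) V × Matrix (Fin n) (Fin m) V × Matrix (Fin m) (Fin n) V)
  | _, 0, _, _ =>
      pure (Matrix.of fun i _ => i.elim0, Matrix.of fun _ j => j.elim0, Matrix.of fun i _ => i.elim0)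
  | _, 1, h, A => do
      let (ρ, w, y) ← householder h fun i => A i 0
      pure (Matrix.of fun _ _ => ρ, Matrix.of fun i _ => w i, Matrix.of fun _ j => y j)
  | n, m + 2, h, A => do
      let zero ← Prog.literal 0
      have hl : (m + 2) / 2 ≤ m + 2 := Nat.div_le_self _ _
      have hn : (m + 2) / 2 ≤ n := hl.trans h
      -- factor the left half
      let (RL, WL, YL) ← qrr mm n ((m + 2) / 2) hn (leftCols hl A)
      -- update the right half
      let YA ← rectMul mm YL (rightCols hl A)
      let WYA ← rectMul mm WL YA
      let AR ← matSub (rightCols hl A) WYA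
      -- factor the lower part of the right half
      let (RR, WR, YR) ← qrr mm (n - (m + 2) / 2) (m + 2 - (m + 2) / 2) (by omega) (bottomRows hn AR)
      -- multiply the two orthogonal factors
      let YW ← rectMul mm YR (bottomRows hn WL)
      let WYW ← rectMul mm WR YW
      let XB ← matSub (bottomRows hn WL) WYW
      let X : Matrix (Fin n) (Fin ((m + 2) / 2)) V := vcat (topRows hn WL) XB
      pure (vcat (hcat RL (topRows hn AR)) (hcat (constMat _ _ zero) RR),
        hcat X (vcat (constMat _ _ zero) WR),
        vcat YL (hcat (constMat _ _ zero) YR))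
  termination_by _ m => m
  decreasing_by all_goals omega

/-! ### Rules for executions -/

namespace Prog

variable {α β : Type} {ε : ℝ}

/-! Stability. The proof tracks how far each computed object is from an exactly orthogonal one. The
invariant `IsApproxQR` says that `1 - W * Y` is close to some orthogonal `Q` which carries a
slightly perturbed `A` exactly to `[R; 0]`. It also says that `W` and `Y` have norm at most linear
in the number of columns, which keeps rounding errors from being amplified in later products.

For one column (`exec_householder_error`), the sign choice rules out cancellation in `v`, so `v` and
its length have small relative error and the computed reflection is near the exact one. For more
columns (`isApproxQR_step`), the natural orthogonal factor is `diag(1, QR) * QL`. Up to the rounding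
in `X`, `1 - W * Y` is the product of the two embedded computed factors, and the errors on the right
half of `A` are pulled back through `QLᵀ`, which does not enlarge them. The only other input is the
error of an update `B - W (Y B)` (`update_error`), which rests on the stability of blocked
multiplication (`eventually_rectMul_norm_sub_le`).

The errors then add up over the recursion tree: it has `m` leaves and `m - 1` inner nodes, so
charging a fixed amount to each node gives the factor `2 m - 1` in `isApproxQR_of_exec`. Terms of
second order are absorbed by taking `ε` small depending on `n`. Since only some polynomial in `n` is
required, spectral norms are freely estimated through entries.

Cost. Every product in the recursion has smallest dimension `l = ⌊m/2⌋`, so blocking makes it cost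
`O(n m l^(γ-2))`, which is `O(n m^(γ-1))` because `γ > 2`. Since `γ - 1 > 1`, splitting `m` in two
shrinks the sum of the `(γ-1)`-th powers by a fixed factor (`rpow_add_rpow_le`), so the work decays
geometrically from level to level and the top level dominates (`exec_qrr_cost`). -/

theorem exec_pure {a b : α} {t : ℕ} :
    (pure a : Prog ℝ α).Exec ε b t ↔ b = a ∧ t = 0 := Iff.rfl

/-- With this rule, `simp` turns a run of monadic code into nested existentials, one for each
intermediate value. -/
theorem exec_bind {p : Prog ℝ α} {f : α → Prog ℝ β} {b : β} {t : ℕ} :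
    (p >>= f).Exec ε b t ↔ ∃ a s u, p.Exec ε a s ∧ (f a).Exec ε b u ∧ t = s + u := by
  change (p.bind f).Exec ε b t ↔ _
  induction p generalizing t with
  | ret a =>
    simp only [bind, Exec]
    constructor
    · exact fun h => ⟨a, 0, t, ⟨rfl, rfl⟩, h, (Nat.zero_add t).symm⟩
    · rintro ⟨a', s, u, ⟨rfl, rfl⟩, h, rfl⟩
      rwa [Nat.zero_add]
  | const c k ih => simp only [bind, Exec, ih]
  | arith o x y k ih =>
    simp only [bind, Exec, ih]
    constructor
    · rintro ⟨z, s, hz, ⟨a, s', u, h, h', rfl⟩, rfl⟩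
      exact ⟨a, s' + 1, u, ⟨z, s', hz, h, rfl⟩, h', by omega⟩
    · rintro ⟨a, s, u, ⟨z, s', hz, h, rfl⟩, h', rfl⟩
      exact ⟨z, s' + u, hz, ⟨a, s', u, h, h', rfl⟩, by omega⟩
  | sqrt x k ih =>
    simp only [bind, Exec, ih]
    constructor
    · rintro ⟨z, s, hz, ⟨a, s', u, h, h', rfl⟩, rfl⟩
      exact ⟨a, s' + 1, u, ⟨z, s', hz, h, rfl⟩, h', by omega⟩
    · rintro ⟨a, s, u, ⟨z, s', hz, h, rfl⟩, h', rfl⟩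
      exact ⟨z, s' + u, hz, ⟨a, s', u, h, h', rfl⟩, by omega⟩
  | less x y k ih =>
    simp only [bind, Exec, ih]
    constructor
    · rintro ⟨s, ⟨a, s', u, h, h', rfl⟩, rfl⟩
      exact ⟨a, s' + 1, u, ⟨s', h, rfl⟩, h', by omega⟩
    · rintro ⟨a, s, u, ⟨s', h, rfl⟩, h', rfl⟩
      exact ⟨s' + u, ⟨a, s', u, h, h', rfl⟩, by omega⟩

theorem exec_literal {c z : ℝ} {t : ℕ} :
    (literal c : Prog ℝ ℝ).Exec ε z t ↔ z = c ∧ t = 0 := Iff.rfl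

theorem exec_arith {o : ArithOp} {x y z : ℝ} {t : ℕ} :
    (arith o x y ret : Prog ℝ ℝ).Exec ε z t ↔ |z - o.eval x y| ≤ ε * |o.eval x y| ∧ t = 1 := by
  simp only [Exec]
  constructor
  · rintro ⟨z, s, hz, ⟨rfl, rfl⟩, rfl⟩
    exact ⟨hz, rfl⟩
  · rintro ⟨hz, rfl⟩
    exact ⟨z, 0, hz, ⟨rfl, rfl⟩, rfl⟩

theorem exec_fadd {x y z : ℝ} {t : ℕ} :
    (fadd x y).Exec ε z t ↔ |z - (x + y)| ≤ ε * |x + y| ∧ t = 1 := exec_arith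

theorem exec_fsub {x y z : ℝ} {t : ℕ} :
    (fsub x y).Exec ε z t ↔ |z - (x - y)| ≤ ε * |x - y| ∧ t = 1 := exec_arith

theorem exec_fmul {x y z : ℝ} {t : ℕ} :
    (fmul x y).Exec ε z t ↔ |z - x * y| ≤ ε * |x * y| ∧ t = 1 := exec_arith

theorem exec_fdiv {x y z : ℝ} {t : ℕ} :
    (fdiv x y).Exec ε z t ↔ |z - x / y| ≤ ε * |x / y| ∧ t = 1 := exec_arith

theorem exec_fsqrt {x z : ℝ} {t : ℕ} :
    (fsqrt x).Exec ε z t ↔ |z - √x| ≤ ε * |√x| ∧ t = 1 := by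
  simp only [fsqrt, Exec]
  constructor
  · rintro ⟨z, s, hz, ⟨rfl, rfl⟩, rfl⟩
    exact ⟨hz, rfl⟩
  · rintro ⟨hz, rfl⟩
    exact ⟨z, 0, hz, ⟨rfl, rfl⟩, rfl⟩

open Classical in
theorem exec_isLess {x y : ℝ} {b : Bool} {t : ℕ} :
    (isLess x y).Exec ε b t ↔ b = decide (x < y) ∧ t = 1 := by
  simp only [isLess, Exec]
  constructor
  · rintro ⟨s, ⟨rfl, rfl⟩, rfl⟩
    exact ⟨rfl, rfl⟩
  · rintro ⟨rfl, rfl⟩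
    exact ⟨0, ⟨rfl, rfl⟩, rfl⟩

theorem Exec.tabulate {n : ℕ} {f : Fin n → Prog ℝ α} {g : Fin n → α} {t : ℕ}
    (h : (tabulate f).Exec ε g t) :
    ∃ ts : Fin n → ℕ, (∀ i, (f i).Exec ε (g i) (ts i)) ∧ t = ∑ i, ts i := by
  induction n generalizing t with
  | zero =>
    obtain ⟨-, rfl⟩ := h
    exact ⟨fun _ => 0, fun i => i.elim0, by simp⟩
  | succ n ih =>
    simp only [Prog.tabulate, exec_bind, exec_pure] at h
    obtain ⟨a, s, u, ha, ⟨g', s', u', hg, ⟨rfl, rfl⟩, rfl⟩, rfl⟩ := h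
    obtain ⟨ts, hts, rfl⟩ := ih hg
    refine ⟨Fin.cons s ts, fun i => ?_, by simp [Fin.sum_univ_succ]⟩
    refine Fin.cases ?_ (fun i => ?_) i
    · simpa using ha
    · simpa using hts i

/-- If every component takes at most `c` operations, then tabulation takes at most `n * c`. -/
theorem sum_le_of_forall_le {n c : ℕ} {ts : Fin n → ℕ} (h : ∀ i, ts i ≤ c) :
    ∑ i, ts i ≤ n * c := by
  simpa using Finset.sum_le_card_nsmul Finset.univ ts c fun i _ => h i

/-- The invariant rule for loops; the invariant refers to the list of the elements handled so far,
the current state, and the number of operations. -/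
theorem Exec.foldlM_append {f : β → α → Prog ℝ β} (I : List α → β → ℕ → Prop)
    (step : ∀ l a b b' s u, I l b s → (f b a).Exec ε b' u → I (l ++ [a]) b' (s + u))
    (l pre : List α) {init b : β} {s t : ℕ} (hI : I pre init s)
    (h : (l.foldlM f init).Exec ε b t) : I (pre ++ l) b (s + t) := by
  induction l generalizing pre init s t with
  | nil =>
    obtain ⟨rfl, rfl⟩ := h
    simpa using hI
  | cons a l ih =>
    rw [List.foldlM_cons, exec_bind] at h
    obtain ⟨b', s', u, hb', h, rfl⟩ := h
    have := ih (pre ++ [a]) (step pre a _ b' s s' hI hb') h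
    simpa [add_assoc] using this

theorem Exec.foldlM {f : β → α → Prog ℝ β} (I : List α → β → ℕ → Prop)
    (step : ∀ l a b b' s u, I l b s → (f b a).Exec ε b' u → I (l ++ [a]) b' (s + u))
    {l : List α} {init b : β} {t : ℕ} (hI : I [] init 0)
    (h : (l.foldlM f init).Exec ε b t) : I l b t := by
  simpa using Exec.foldlM_append I step l [] hI h

end Prog

open Prog

/-- Floating-point matrix addition is exact up to entrywise relative errors. -/
theorem exec_matAdd {ε : ℝ} {n m : ℕ} {A B S : Matrix (Fin n) (Fin m) ℝ} {t : ℕ}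
    (h : (matAdd A B).Exec ε S t) :
    (∀ i j, |S i j - (A + B) i j| ≤ ε * |(A + B) i j|) ∧ t = n * m := by
  obtain ⟨ts, hts, rfl⟩ := h.tabulate
  choose us hus hts using fun i => (hts i).tabulate
  simp only [exec_fadd] at hus
  refine ⟨fun i j => (hus i j).1, ?_⟩
  simp [hts, fun i j => (hus i j).2]

/-- Floating-point matrix subtraction is exact up to entrywise relative errors. -/
theorem exec_matSub {ε : ℝ} {n m : ℕ} {A B S : Matrix (Fin n) (Fin m) ℝ} {t : ℕ}
    (h : (matSub A B).Exec ε S t) :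
    (∀ i j, |S i j - (A - B) i j| ≤ ε * |(A - B) i j|) ∧ t = n * m := by
  obtain ⟨ts, hts, rfl⟩ := h.tabulate
  choose us hus hts using fun i => (hts i).tabulate
  simp only [exec_fsub] at hus
  refine ⟨fun i j => (hus i j).1, ?_⟩
  simp [hts, fun i j => (hus i j).2]

/-- The count is settled here, while the summation loop is left as a run, to be analysed for
rounding in `exec_sumSq_bounds`. -/
theorem exec_vecLength {ε : ℝ} {n : ℕ} {x : Fin n → ℝ} {σ : ℝ} {t : ℕ}
    (h : (vecLength x).Exec ε σ t) :
    (∃ s u, ((List.finRange n).foldlM (m := Prog ℝ) (fun acc i => do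
        let p ← Prog.fmul (x i) (x i)
        Prog.fadd acc p) (0 : ℝ)).Exec ε s u ∧ |σ - √s| ≤ ε * |√s|) ∧ t = 2 * n + 1 := by
  simp only [vecLength, exec_bind, exec_literal, exec_fsqrt] at h
  obtain ⟨z, _, _, ⟨rfl, rfl⟩, ⟨s, u, _, hs, ⟨hσ, rfl⟩, rfl⟩, rfl⟩ := h
  refine ⟨⟨s, u, hs, hσ⟩, ?_⟩
  have := Exec.foldlM (fun l _ t => t = 2 * l.length) ?_ rfl hs
  · simp at this
    omega
  · rintro l a b b' s u rfl h
    simp only [exec_bind, exec_fmul, exec_fadd] at h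
    obtain ⟨p, _, _, ⟨-, rfl⟩, ⟨-, rfl⟩, rfl⟩ := h
    simp
    omega

/-! ### Block matrices as products with partial identity matrices -/

section Embeddings

variable {n m a : ℕ}

/-- The `n`-by-`a` matrix `[I; 0]`. -/
def topEmb (h : a ≤ n) : Matrix (Fin n) (Fin a) ℝ :=
  (1 : Matrix (Fin n) (Fin n) ℝ).submatrix id (Fin.castLE h)

/-- The `n`-by-`(n - a)` matrix `[0; I]`. -/
def botEmb (h : a ≤ n) : Matrix (Fin n) (Fin (n - a)) ℝ :=
  (1 : Matrix (Fin n) (Fin n) ℝ).submatrix id (upperIdx h)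

theorem castLE_or_upperIdx (h : a ≤ n) (i : Fin n) :
    (∃ j, i = Fin.castLE h j) ∨ ∃ j, i = upperIdx h j := by
  by_cases hi : i.val < a
  · exact Or.inl ⟨⟨i, hi⟩, rfl⟩
  · exact Or.inr ⟨⟨i - a, by omega⟩, Fin.ext (by simp [upperIdx]; omega)⟩

theorem upperIdx_inj {h : a ≤ n} {i j : Fin (n - a)} : upperIdx h i = upperIdx h j ↔ i = j := by
  simp [upperIdx, Fin.ext_iff]

theorem castLE_ne_upperIdx (h : a ≤ n) (i : Fin a) (j : Fin (n - a)) :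
    Fin.castLE h i ≠ upperIdx h j := by
  simp [upperIdx, Fin.ext_iff]
  omega

theorem glue_castLE {α : Type} (h : a ≤ n) (f : Fin a → α) (g : Fin (n - a) → α) (i : Fin a) :
    glue f g (Fin.castLE h i) = f i := by
  simp [glue]

theorem glue_upperIdx {α : Type} (h : a ≤ n) (f : Fin a → α) (g : Fin (n - a) → α)
    (i : Fin (n - a)) : glue f g (upperIdx h i) = g i := by
  simp [glue, upperIdx]

theorem leftCols_eq (h : a ≤ m) (A : Matrix (Fin n) (Fin m) ℝ) : leftCols h A = A * topEmb h := by
  ext i j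
  simp [leftCols, topEmb, Matrix.mul_apply, Matrix.one_apply]

theorem rightCols_eq (h : a ≤ m) (A : Matrix (Fin n) (Fin m) ℝ) : rightCols h A = A * botEmb h := by
  ext i j
  simp [rightCols, botEmb, Matrix.mul_apply, Matrix.one_apply]

theorem topRows_eq (h : a ≤ n) (A : Matrix (Fin n) (Fin m) ℝ) :
    topRows h A = (topEmb h).transpose * A := by
  ext i j
  simp [topRows, topEmb, Matrix.mul_apply, Matrix.one_apply]

theorem bottomRows_eq (h : a ≤ n) (A : Matrix (Fin n) (Fin m) ℝ) :
    bottomRows h A = (botEmb h).transpose * A := by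
  ext i j
  simp [bottomRows, botEmb, Matrix.mul_apply, Matrix.one_apply]

theorem topEmb_transpose_mul_topEmb (h : a ≤ n) : (topEmb h).transpose * topEmb h = 1 := by
  rw [← topRows_eq]
  ext i j
  simp [topRows, topEmb, Matrix.one_apply]

theorem botEmb_transpose_mul_botEmb (h : a ≤ n) : (botEmb h).transpose * botEmb h = 1 := by
  rw [← bottomRows_eq]
  ext i j
  simp [bottomRows, botEmb, Matrix.one_apply, upperIdx_inj]

theorem topEmb_transpose_mul_botEmb (h : a ≤ n) : (topEmb h).transpose * botEmb h = 0 := by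
  rw [← topRows_eq]
  ext i j
  simp [topRows, botEmb, castLE_ne_upperIdx]

theorem botEmb_transpose_mul_topEmb (h : a ≤ n) : (botEmb h).transpose * topEmb h = 0 := by
  rw [← bottomRows_eq]
  ext i j
  simp [bottomRows, topEmb, (castLE_ne_upperIdx h _ _).symm]

/-- Together with the four preceding product rules, this makes the embeddings a pair of isometries
with complementary ranges. Block matrices become ordinary sums of products, and cutting out or
inserting blocks never increases the spectral norm. -/
theorem topEmb_mul_transpose_add (h : a ≤ n) :
    topEmb h * (topEmb h).transpose + botEmb h * (botEmb h).transpose = 1 := by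
  ext i j
  obtain ⟨i, rfl⟩ | ⟨i, rfl⟩ := castLE_or_upperIdx h i <;>
    obtain ⟨j, rfl⟩ | ⟨j, rfl⟩ := castLE_or_upperIdx h j <;>
    simp [topEmb, botEmb, Matrix.mul_apply, Matrix.one_apply, upperIdx_inj, castLE_ne_upperIdx,
      (castLE_ne_upperIdx h _ _).symm]

theorem vcat_eq (h : a ≤ n) (A : Matrix (Fin a) (Fin m) ℝ) (B : Matrix (Fin (n - a)) (Fin m) ℝ) :
    (vcat A B : Matrix (Fin n) (Fin m) ℝ) = topEmb h * A + botEmb h * B := by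
  have hA : topRows h (vcat A B) = A := by
    ext i j
    exact glue_castLE h (fun i => A i j) (fun i => B i j) i
  have hB : bottomRows h (vcat A B) = B := by
    ext i j
    exact glue_upperIdx h (fun i => A i j) (fun i => B i j) i
  rw [topRows_eq] at hA
  rw [bottomRows_eq] at hB
  calc (vcat A B : Matrix (Fin n) (Fin m) ℝ)
      = (topEmb h * (topEmb h).transpose + botEmb h * (botEmb h).transpose) * vcat A B := by
        rw [topEmb_mul_transpose_add, Matrix.one_mul]
    _ = _ := by rw [Matrix.add_mul, Matrix.mul_assoc, Matrix.mul_assoc, hA, hB]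

theorem hcat_eq (h : a ≤ m) (A : Matrix (Fin n) (Fin a) ℝ) (B : Matrix (Fin n) (Fin (m - a)) ℝ) :
    (hcat A B : Matrix (Fin n) (Fin m) ℝ) =
      A * (topEmb h).transpose + B * (botEmb h).transpose := by
  have : (hcat A B : Matrix (Fin n) (Fin m) ℝ) = (vcat A.transpose B.transpose).transpose := rfl
  rw [this, vcat_eq h]
  simp [Matrix.transpose_add]

theorem constMat_zero : constMat n m (0 : ℝ) = 0 := rfl

end Embeddings

/-! ### The spectral norm -/

section SpectralNorm

variable {p q r : ℕ}

theorem norm_transpose_eq (A : Matrix (Fin p) (Fin q) ℝ) : ‖A.transpose‖ = ‖A‖ := by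
  rw [← Matrix.l2_opNorm_conjTranspose A, Matrix.conjTranspose_eq_transpose_of_trivial]

theorem norm_one_le : ‖(1 : Matrix (Fin p) (Fin p) ℝ)‖ ≤ 1 := by
  rw [← Matrix.diagonal_one, Matrix.l2_opNorm_diagonal]
  exact (pi_norm_le_iff_of_nonneg zero_le_one).2 fun i => by simp

theorem norm_le_one_of_transpose_mul_self {U : Matrix (Fin p) (Fin q) ℝ}
    (h : U.transpose * U = 1) : ‖U‖ ≤ 1 := by
  have := Matrix.l2_opNorm_conjTranspose_mul_self U
  rw [Matrix.conjTranspose_eq_transpose_of_trivial, h] at this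
  nlinarith [norm_one_le (p := q), norm_nonneg U]

theorem matrix_norm_mul_le_of_le {A : Matrix (Fin p) (Fin q) ℝ} {B : Matrix (Fin q) (Fin r) ℝ} {a b : ℝ}
    (hA : ‖A‖ ≤ a) (hB : ‖B‖ ≤ b) : ‖A * B‖ ≤ a * b :=
  (Matrix.l2_opNorm_mul A B).trans
    (mul_le_mul hA hB (norm_nonneg _) ((norm_nonneg _).trans hA))

theorem norm_contraction_mul_le {U : Matrix (Fin p) (Fin q) ℝ} (hU : ‖U‖ ≤ 1)
    (A : Matrix (Fin q) (Fin r) ℝ) : ‖U * A‖ ≤ ‖A‖ := by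
  simpa using matrix_norm_mul_le_of_le hU (le_refl ‖A‖)

theorem norm_mul_contraction_le {U : Matrix (Fin q) (Fin r) ℝ} (hU : ‖U‖ ≤ 1)
    (A : Matrix (Fin p) (Fin q) ℝ) : ‖A * U‖ ≤ ‖A‖ := by
  simpa using matrix_norm_mul_le_of_le (le_refl ‖A‖) hU

theorem abs_entry_le_norm (A : Matrix (Fin p) (Fin q) ℝ) (i : Fin p) (j : Fin q) :
    |A i j| ≤ ‖A‖ := by
  have h := A.l2_opNorm_mulVec (EuclideanSpace.single j 1)
  rw [PiLp.norm_single, norm_one, mul_one] at h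
  refine le_trans ?_ h
  have := PiLp.norm_apply_le (WithLp.toLp 2 (A.mulVec (EuclideanSpace.single j (1 : ℝ)).ofLp)) i
  simpa using this

/-- Cauchy–Schwarz in each row, then summation over the rows. The loss of a factor `N` is harmless,
because all final bounds are merely polynomial in the dimension. -/
theorem norm_le_of_forall_abs_le {A : Matrix (Fin p) (Fin q) ℝ} {c : ℝ} (hc : 0 ≤ c) {N : ℕ}
    (hp : p ≤ N) (hq : q ≤ N) (h : ∀ i j, |A i j| ≤ c) : ‖A‖ ≤ N * c := by
  rw [Matrix.l2_opNorm_def]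
  refine ContinuousLinearMap.opNorm_le_bound _ (by positivity) fun x => ?_
  have hp' : (p : ℝ) ≤ N := by exact_mod_cast hp
  have hq' : (q : ℝ) ≤ N := by exact_mod_cast hq
  have hx : (∑ j, |x j|) ^ 2 ≤ N * ‖x‖ ^ 2 := by
    have h1 := sq_sum_le_card_mul_sum_sq (s := Finset.univ) (f := fun j => |x j|)
    rw [EuclideanSpace.real_norm_sq_eq]
    simp only [sq_abs, Finset.card_univ, Fintype.card_fin] at h1
    exact h1.trans (mul_le_mul_of_nonneg_right hq' (Finset.sum_nonneg fun _ _ => sq_nonneg _))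
  have hi : ∀ i, (A.mulVec x.ofLp i) ^ 2 ≤ c ^ 2 * (N * ‖x‖ ^ 2) := fun i => by
    have : |A.mulVec x.ofLp i| ≤ c * ∑ j, |x j| := by
      rw [Matrix.mulVec, dotProduct, Finset.mul_sum]
      refine (Finset.abs_sum_le_sum_abs _ _).trans (Finset.sum_le_sum fun j _ => ?_)
      rw [abs_mul]
      exact mul_le_mul_of_nonneg_right (h i j) (abs_nonneg _)
    calc (A.mulVec x.ofLp i) ^ 2 = |A.mulVec x.ofLp i| ^ 2 := (sq_abs _).symm
      _ ≤ (c * ∑ j, |x j|) ^ 2 := pow_le_pow_left₀ (abs_nonneg _) this 2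
      _ = c ^ 2 * (∑ j, |x j|) ^ 2 := by ring
      _ ≤ _ := mul_le_mul_of_nonneg_left hx (sq_nonneg _)
  refine le_of_sq_le_sq ?_ (by positivity)
  change ‖WithLp.toLp 2 (A.mulVec x.ofLp)‖ ^ 2 ≤ _
  rw [EuclideanSpace.real_norm_sq_eq]
  calc ∑ i, (A.mulVec x.ofLp i) ^ 2 ≤ ∑ _i : Fin p, c ^ 2 * (N * ‖x‖ ^ 2) :=
        Finset.sum_le_sum fun i _ => hi i
    _ = p * (c ^ 2 * (N * ‖x‖ ^ 2)) := by simp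
    _ ≤ N * (c ^ 2 * (N * ‖x‖ ^ 2)) := mul_le_mul_of_nonneg_right hp' (by positivity)
    _ = (N * c * ‖x‖) ^ 2 := by ring

/-- An entrywise relative perturbation is a small relative perturbation in the spectral norm. -/
theorem norm_sub_le_of_entrywise {S A : Matrix (Fin p) (Fin q) ℝ} {ε : ℝ} (hε : 0 ≤ ε) {N : ℕ}
    (hp : p ≤ N) (hq : q ≤ N) (h : ∀ i j, |S i j - A i j| ≤ ε * |A i j|) :
    ‖S - A‖ ≤ N * ε * ‖A‖ := by
  rw [mul_assoc]
  exact norm_le_of_forall_abs_le (by positivity) hp hq fun i j =>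
    (h i j).trans (mul_le_mul_of_nonneg_left (abs_entry_le_norm A i j) hε)

theorem norm_topEmb_le {n a : ℕ} (h : a ≤ n) : ‖topEmb h‖ ≤ 1 :=
  norm_le_one_of_transpose_mul_self (topEmb_transpose_mul_topEmb h)

theorem norm_botEmb_le {n a : ℕ} (h : a ≤ n) : ‖botEmb h‖ ≤ 1 :=
  norm_le_one_of_transpose_mul_self (botEmb_transpose_mul_botEmb h)

theorem norm_topEmb_transpose_le {n a : ℕ} (h : a ≤ n) : ‖(topEmb h).transpose‖ ≤ 1 :=
  (norm_transpose_eq _).trans_le (norm_topEmb_le h)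

theorem norm_botEmb_transpose_le {n a : ℕ} (h : a ≤ n) : ‖(botEmb h).transpose‖ ≤ 1 :=
  (norm_transpose_eq _).trans_le (norm_botEmb_le h)

theorem norm_orthogonal_le {Q : Matrix (Fin p) (Fin p) ℝ}
    (hQ : Q ∈ Matrix.orthogonalGroup (Fin p) ℝ) : ‖Q‖ ≤ 1 :=
  norm_le_one_of_transpose_mul_self ((Matrix.mem_orthogonalGroup_iff' _ _).1 hQ)

end SpectralNorm

/-! ### Rectangular matrix multiplication -/

section RectMul

open Filter Topology

theorem eventually_mul_le_one (c : ℝ) : ∀ᶠ ε in 𝓝[>] (0 : ℝ), c * ε ≤ 1 := by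
  have h : Tendsto (fun ε : ℝ => c * ε) (𝓝[>] 0) (𝓝 0) := by
    have : Tendsto (fun ε : ℝ => c * ε) (𝓝 0) (𝓝 (c * 0)) := (continuous_const_mul c).tendsto 0
    rw [mul_zero] at this
    exact this.mono_left nhdsWithin_le_nhds
  exact (h.eventually (gt_mem_nhds one_pos)).mono fun _ h => le_of_lt h

theorem eventually_pos : ∀ᶠ ε in 𝓝[>] (0 : ℝ), 0 < ε := self_mem_nhdsWithin

/-- The normwise error bound with the second order term absorbed, uniformly in the block size. -/
theorem MatMul.IsStable.eventually {mm : MatMul} (h : mm.IsStable) :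
    ∃ (M : ℝ) (c : ℕ), 0 ≤ M ∧ ∀ N : ℕ, 1 ≤ N → ∀ᶠ ε in 𝓝[>] (0 : ℝ), ∀ k, 1 ≤ k → k ≤ N →
      ∀ (A B P : Matrix (Fin k) (Fin k) ℝ) (t : ℕ), (mm ℝ k A B).Exec ε P t →
        ‖P - A * B‖ ≤ M * N ^ c * ε * ‖A‖ * ‖B‖ := by
  obtain ⟨M, c, h⟩ := h
  refine ⟨|M| + 1, c, by positivity, fun N hN => ?_⟩
  suffices ∀ᶠ ε in 𝓝[>] (0 : ℝ), ∀ k ∈ Finset.Icc 1 N,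
      ∀ (A B P : Matrix (Fin k) (Fin k) ℝ) (t : ℕ), (mm ℝ k A B).Exec ε P t →
        ‖P - A * B‖ ≤ (|M| + 1) * N ^ c * ε * ‖A‖ * ‖B‖ from
    this.mono fun ε h k h1 hk => h k (Finset.mem_Icc.2 ⟨h1, hk⟩)
  rw [Finset.eventually_all]
  intro k hk
  obtain ⟨h1, hk⟩ := Finset.mem_Icc.1 hk
  obtain ⟨L, e, he, h⟩ := h k h1
  filter_upwards [eventually_pos, eventually_mul_le_one L, Ioc_mem_nhdsGT he]
    with ε hε hL hεe A B P t hP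
  refine (h ε hε hεe.2 A B P t hP).trans ?_
  have hk' : (k : ℝ) ^ c ≤ (N : ℝ) ^ c := by gcongr
  have hN' : (1 : ℝ) ≤ (N : ℝ) ^ c := one_le_pow₀ (by exact_mod_cast hN)
  have h2 : M * (k : ℝ) ^ c ≤ |M| * (N : ℝ) ^ c :=
    mul_le_mul (le_abs_self M) hk' (by positivity) (abs_nonneg _)
  have h3 : M * (k : ℝ) ^ c * ε + L * ε ^ 2 ≤ (|M| + 1) * N ^ c * ε := by
    have : M * (k : ℝ) ^ c + L * ε ≤ (|M| + 1) * N ^ c := by linarith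
    calc _ = (M * (k : ℝ) ^ c + L * ε) * ε := by ring
      _ ≤ _ := mul_le_mul_of_nonneg_right this hε.le
  calc _ = (M * (k : ℝ) ^ c * ε + L * ε ^ 2) * (‖A‖ * ‖B‖) := by ring
    _ ≤ ((|M| + 1) * N ^ c * ε) * (‖A‖ * ‖B‖) := mul_le_mul_of_nonneg_right h3 (by positivity)
    _ = _ := by ring

/-- The summation loop of the block algorithm. -/
def blockSum (mm : MatMul) {V : Type} {k : ℕ} (b : ℕ) (Z : Matrix (Fin k) (Fin k) V)
    (X Y : ℕ → Matrix (Fin k) (Fin k) V) : Prog V (Matrix (Fin k) (Fin k) V) :=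
  (List.range b).foldlM (init := Z) fun acc K => do
    let P ← mm V k (X K) (Y K)
    matAdd acc P

/-- The block size enters as a variable with an equation, so that callers can use their own name for
it, such as the splitting index `l`. -/
theorem exec_rectMul {mm : MatMul} {p q r : ℕ} {A : Matrix (Fin p) (Fin q) ℝ}
    {B : Matrix (Fin q) (Fin r) ℝ} {ε : ℝ} {P : Matrix (Fin p) (Fin r) ℝ} {t k : ℕ}
    (hk : k = min p (min q r)) (hk0 : 0 < k) (h : (rectMul mm A B).Exec ε P t) :
    ∃ (S : Fin ((p + k - 1) / k) → Fin ((r + k - 1) / k) → Matrix (Fin k) (Fin k) ℝ)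
      (ts : Fin ((p + k - 1) / k) → Fin ((r + k - 1) / k) → ℕ),
      (∀ (I : Fin ((p + k - 1) / k)) (J : Fin ((r + k - 1) / k)), (blockSum mm ((q + k - 1) / k) 0 (fun K => paddedBlock k 0 A I K)
        (fun K => paddedBlock k 0 B K J)).Exec ε (S I J) (ts I J)) ∧
      (∀ i j, P i j = S ⟨i / k, div_lt_ceilDiv hk0 i.isLt⟩ ⟨j / k, div_lt_ceilDiv hk0 j.isLt⟩
        ⟨i % k, Nat.mod_lt _ hk0⟩ ⟨j % k, Nat.mod_lt _ hk0⟩) ∧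
      t = ∑ I, ∑ J, ts I J := by
  subst hk
  simp only [rectMul, exec_bind, exec_literal, dif_pos hk0, exec_pure] at h
  obtain ⟨_, _, _, ⟨rfl, rfl⟩, ⟨S, s, _, hS, ⟨rfl, rfl⟩, rfl⟩, rfl⟩ := h
  obtain ⟨ts, hts, rfl⟩ := hS.tabulate
  choose us hus hts using fun I => (hts I).tabulate
  exact ⟨S, us, hus, fun i j => rfl, by simp [hts]⟩

theorem exec_rectMul_of_eq_zero {mm : MatMul} {p q r : ℕ} {A : Matrix (Fin p) (Fin q) ℝ}
    {B : Matrix (Fin q) (Fin r) ℝ} {ε : ℝ} {P : Matrix (Fin p) (Fin r) ℝ} {t : ℕ}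
    (hk : min p (min q r) = 0) (h : (rectMul mm A B).Exec ε P t) : P = A * B ∧ t = 0 := by
  simp only [rectMul, exec_bind, exec_literal, dif_neg hk.not_gt, exec_pure] at h
  obtain ⟨_, _, _, ⟨rfl, rfl⟩, ⟨rfl, rfl⟩, rfl⟩ := h
  refine ⟨?_, rfl⟩
  ext i j
  -- The indices `i` and `j` witness that `p` and `r` are positive, so the vanishing minimum must be
  -- `q`.
  obtain rfl : q = 0 := by
    have := i.isLt
    have := j.isLt
    omega
  simp [constMat, Matrix.mul_apply]

/-- Each round of the loop adds at most `(μ + 1 + N (N + 1)) ε x y`: `μ` from the block product, `N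
(N + 1)` from rounding the addition (`N ε` times a partial sum of norm at most `N x y`), and `1` for
the second-order remainder, which `hsmall` controls. -/
theorem exec_blockSum_norm_sub_le {mm : MatMul} {k N b : ℕ} {ε μ x y : ℝ} (hε : 0 < ε)
    (hkN : k ≤ N) (hb : b ≤ N) (hμ : 0 ≤ μ)
    (hmm : ∀ (A B P : Matrix (Fin k) (Fin k) ℝ) (t : ℕ), (mm ℝ k A B).Exec ε P t →
      ‖P - A * B‖ ≤ μ * ε * ‖A‖ * ‖B‖)
    (hsmall : N * (N * (μ + 1 + N * (N + 1)) + μ) * ε ≤ 1)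
    {X Y : ℕ → Matrix (Fin k) (Fin k) ℝ} (hX : ∀ K, ‖X K‖ ≤ x) (hY : ∀ K, ‖Y K‖ ≤ y)
    {S : Matrix (Fin k) (Fin k) ℝ} {t : ℕ} (h : (blockSum mm b 0 X Y).Exec ε S t) :
    ‖S - ∑ K ∈ Finset.range b, X K * Y K‖ ≤ b * ((μ + 1 + N * (N + 1)) * ε * (x * y)) := by
  have hx : 0 ≤ x := (norm_nonneg _).trans (hX 0)
  have hy : 0 ≤ y := (norm_nonneg _).trans (hY 0)
  have hxy : 0 ≤ x * y := mul_nonneg hx hy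
  set D := μ + 1 + N * ((N : ℝ) + 1) with hD
  -- The length restriction is a premise of the invariant, since the loop rule quantifies over
  -- arbitrary prefixes. The bound on the exact partial sum is carried along to estimate the
  -- rounding of the next addition.
  have key := Exec.foldlM (fun l S _ => l.length ≤ N →
    ‖(l.map fun K => X K * Y K).sum‖ ≤ l.length * (x * y) ∧
    ‖S - (l.map fun K => X K * Y K).sum‖ ≤ l.length * (D * ε * (x * y))) ?_ (by simp) h
  · have := (key (by simpa using hb)).2
    rw [List.length_range] at this
    exact this
  · intro l K S S' s u ih hS' hl
    simp only [exec_bind] at hS'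
    obtain ⟨P, s₁, s₂, hP, hS', rfl⟩ := hS'
    obtain ⟨hS', -⟩ := exec_matAdd hS'
    simp only [List.length_append, List.length_singleton] at hl ⊢
    obtain ⟨ih₁, ih₂⟩ := ih (by omega)
    simp only [List.map_append, List.sum_append, List.map_singleton, List.sum_singleton]
    set T := (l.map fun K => X K * Y K).sum
    set b : ℝ := (l.length : ℝ) with hbdef
    have hb0 : 0 ≤ b := Nat.cast_nonneg _
    have hbN : b + 1 ≤ N := by rw [hbdef]; exact_mod_cast hl
    have hN0 : (0 : ℝ) ≤ N := Nat.cast_nonneg _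
    have hXY : ‖X K * Y K‖ ≤ x * y := matrix_norm_mul_le_of_le (hX K) (hY K)
    have hPe : ‖P - X K * Y K‖ ≤ μ * ε * (x * y) := by
      refine (hmm _ _ _ _ hP).trans ?_
      rw [mul_assoc]
      exact mul_le_mul_of_nonneg_left (mul_le_mul (hX K) (hY K) (norm_nonneg _) hx)
        (by positivity)
    have hT : ‖T + X K * Y K‖ ≤ (b + 1) * (x * y) := by
      refine (norm_add_le _ _).trans ?_
      linarith
    have h1 : ‖S + P - (T + X K * Y K)‖ ≤ (b * D + μ) * ε * (x * y) := by
      calc ‖S + P - (T + X K * Y K)‖ = ‖(S - T) + (P - X K * Y K)‖ := by congr 1; abel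
        _ ≤ ‖S - T‖ + ‖P - X K * Y K‖ := norm_add_le _ _
        _ ≤ _ := by linarith
    have h2 : ‖S + P‖ ≤ (b * D + μ) * ε * (x * y) + (b + 1) * (x * y) := by
      calc ‖S + P‖ = ‖(S + P - (T + X K * Y K)) + (T + X K * Y K)‖ := by congr 1; abel
        _ ≤ _ := (norm_add_le _ _).trans (add_le_add h1 hT)
    have h3 : ‖S' - (S + P)‖ ≤ N * ε * ‖S + P‖ := norm_sub_le_of_entrywise hε.le hkN hkN hS'
    have hD0 : 0 ≤ D := by positivity
    refine ⟨by push_cast; exact hT, ?_⟩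
    have h4 : N * ε * ‖S + P‖ ≤ (1 + N * (N + 1)) * ε * (x * y) := by
      have h5 : N * ε * (b * D + μ) ≤ 1 := by
        refine le_trans ?_ hsmall
        calc N * ε * (b * D + μ) ≤ N * ε * (N * D + μ) := by
              have : b * D ≤ N * D := mul_le_mul_of_nonneg_right (by linarith) hD0
              exact mul_le_mul_of_nonneg_left (by linarith) (by positivity)
          _ = _ := by ring
      calc N * ε * ‖S + P‖ ≤ N * ε * ((b * D + μ) * ε * (x * y) + (b + 1) * (x * y)) :=
            mul_le_mul_of_nonneg_left h2 (by positivity)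
        _ = (N * ε * (b * D + μ) + N * (b + 1)) * (ε * (x * y)) := by ring
        _ ≤ (1 + N * (N + 1)) * (ε * (x * y)) := by
            have : N * (b + 1) ≤ N * ((N : ℝ) + 1) :=
              mul_le_mul_of_nonneg_left (by linarith) hN0
            exact mul_le_mul_of_nonneg_right (by linarith) (by positivity)
        _ = _ := by ring
    calc ‖S' - (T + X K * Y K)‖ = ‖(S' - (S + P)) + (S + P - (T + X K * Y K))‖ := by
          congr 1; abel
      _ ≤ (1 + N * (N + 1)) * ε * (x * y) + (b * D + μ) * ε * (x * y) :=
          (norm_add_le _ _).trans (add_le_add (h3.trans h4) h1)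
      _ = _ := by push_cast; rw [hD]; ring

theorem abs_paddedBlock_le {p q k : ℕ} (A : Matrix (Fin p) (Fin q) ℝ) (I J : ℕ) (i j : Fin k) :
    |paddedBlock k 0 A I J i j| ≤ ‖A‖ := by
  simp only [paddedBlock, Matrix.of_apply]
  split_ifs
  · exact abs_entry_le_norm _ _ _
  · simp

theorem sum_range_mul_eq (f : ℕ → ℝ) (b k : ℕ) :
    ∑ s ∈ Finset.range (b * k), f s =
      ∑ K ∈ Finset.range b, ∑ κ ∈ Finset.range k, f (K * k + κ) := by
  induction b with
  | zero => simp
  | succ b ih => rw [Nat.succ_mul, Finset.sum_range_add, ih, Finset.sum_range_succ]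

/-- The blocks of a product are sums of products of blocks. -/
theorem mul_apply_eq_sum_paddedBlock {p q r k : ℕ} (hk : 0 < k) (A : Matrix (Fin p) (Fin q) ℝ)
    (B : Matrix (Fin q) (Fin r) ℝ) (i : Fin p) (j : Fin r) :
    (A * B) i j = (∑ K ∈ Finset.range ((q + k - 1) / k),
      paddedBlock k 0 A (i / k) K * paddedBlock k 0 B K (j / k))
        ⟨i % k, Nat.mod_lt _ hk⟩ ⟨j % k, Nat.mod_lt _ hk⟩ := by
  set b := (q + k - 1) / k with hb
  let f : ℕ → ℝ := fun s => if hs : s < q then A i ⟨s, hs⟩ * B ⟨s, hs⟩ j else 0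
  have hq : q ≤ b * k := by
    have h1 := Nat.div_add_mod' (q + k - 1) k
    have h2 := Nat.mod_lt (q + k - 1) hk
    rw [← hb] at h1
    omega
  have hi : i.val / k * k + i.val % k = i.val := Nat.div_add_mod' _ _
  have hj : j.val / k * k + j.val % k = j.val := Nat.div_add_mod' _ _
  calc (A * B) i j = ∑ s : Fin q, f s := by simp [Matrix.mul_apply, f]
    _ = ∑ s ∈ Finset.range q, f s := Fin.sum_univ_eq_sum_range f q
    -- The added terms are zero: this is the zero padding at the border.
    _ = ∑ s ∈ Finset.range (b * k), f s := by
        refine Finset.sum_subset (Finset.range_mono hq) fun s _ hs => ?_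
        simp only [Finset.mem_range] at hs
        simp [f, hs]
    _ = ∑ K ∈ Finset.range b, ∑ κ : Fin k, f (K * k + κ) := by
        rw [sum_range_mul_eq]
        exact Finset.sum_congr rfl fun K _ =>
          (Fin.sum_univ_eq_sum_range (fun κ => f (K * k + κ)) k).symm
    _ = _ := by
        rw [Matrix.sum_apply]
        refine Finset.sum_congr rfl fun K _ => ?_
        rw [Matrix.mul_apply]
        refine Finset.sum_congr rfl fun κ _ => ?_
        simp only [paddedBlock, Matrix.of_apply, hi, hj, i.isLt, j.isLt, true_and, and_true, f]
        split_ifs <;> simp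

/-- Stability of the rectangular multiplication, uniformly in the dimensions up to `N`. -/
theorem eventually_rectMul_norm_sub_le {mm : MatMul} (h : mm.IsStable) :
    ∃ (D : ℝ) (d : ℕ), 0 ≤ D ∧ ∀ N : ℕ, 1 ≤ N → ∀ᶠ ε in 𝓝[>] (0 : ℝ), ∀ p q r : ℕ,
      p ≤ N → q ≤ N → r ≤ N → ∀ (A : Matrix (Fin p) (Fin q) ℝ) (B : Matrix (Fin q) (Fin r) ℝ)
        (P : Matrix (Fin p) (Fin r) ℝ) (t : ℕ), (rectMul mm A B).Exec ε P t →
          ‖P - A * B‖ ≤ D * N ^ d * ε * (‖A‖ * ‖B‖) := by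
  obtain ⟨M, c, hM, h⟩ := h.eventually
  refine ⟨M + 3, c + 6, by positivity, fun N hN => ?_⟩
  filter_upwards [h N hN, eventually_pos,
    eventually_mul_le_one (N * (N * (M * N ^ c + 1 + N * (N + 1)) + M * N ^ c))]
    with ε hmm hε hsmall p q r hp hq hr A B P t hP
  have hN1 : (1 : ℝ) ≤ N := by exact_mod_cast hN
  rcases Nat.eq_zero_or_pos (min p (min q r)) with hk | hk
  · rw [(exec_rectMul_of_eq_zero hk hP).1, sub_self, norm_zero]
    positivity
  obtain ⟨k, hkdef⟩ : ∃ k, k = min p (min q r) := ⟨_, rfl⟩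
  rw [← hkdef] at hk
  have hkN : k ≤ N := by omega
  obtain ⟨S, ts, hS, hPS, -⟩ := exec_rectMul hkdef hk hP
  set b := (q + k - 1) / k with hb
  have hbN : b ≤ N := by
    refine le_trans ?_ hq
    rw [hb, Nat.div_le_iff_le_mul_add_pred hk]
    have : q ≤ k * q := Nat.le_mul_of_pos_left q hk
    omega
  have hbN' : (b : ℝ) ≤ N := by exact_mod_cast hbN
  set D := M * N ^ c + 1 + N * ((N : ℝ) + 1) with hD
  have hD0 : 0 ≤ D := by positivity
  -- A padded block has entries at most `‖A‖`, hence norm at most `N ‖A‖`. The two block norms, the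
  -- number of blocks and the passage from entries back to the norm each cost one factor `N`, giving
  -- `N ^ 4`.
  have hbound : ∀ i j, |(P - A * B) i j| ≤ N * (D * ε * ((N * ‖A‖) * (N * ‖B‖))) := by
    intro i j
    have := exec_blockSum_norm_sub_le hε hkN hbN (by positivity) (hmm k hk hkN) hsmall
      (fun K => norm_le_of_forall_abs_le (norm_nonneg A) hkN hkN
        (abs_paddedBlock_le A (i / k) K))
      (fun K => norm_le_of_forall_abs_le (norm_nonneg B) hkN hkN
        (abs_paddedBlock_le B K (j / k)))
      (hS ⟨i / k, div_lt_ceilDiv hk i.isLt⟩ ⟨j / k, div_lt_ceilDiv hk j.isLt⟩)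
    rw [Matrix.sub_apply, hPS, mul_apply_eq_sum_paddedBlock hk, ← Matrix.sub_apply]
    refine (abs_entry_le_norm _ _ _).trans (this.trans ?_)
    exact mul_le_mul_of_nonneg_right hbN' (by positivity)
  refine (norm_le_of_forall_abs_le (by positivity) hp hr hbound).trans ?_
  have hDN : D ≤ (M + 3) * N ^ (c + 2) := by
    have h1 : (N : ℝ) ^ c ≤ N ^ (c + 2) := pow_le_pow_right₀ hN1 (by omega)
    have h2 : (N : ℝ) ^ 2 ≤ N ^ (c + 2) := pow_le_pow_right₀ hN1 (by omega)
    nlinarith [mul_le_mul_of_nonneg_left h1 hM]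
  calc N * (N * (D * ε * (N * ‖A‖ * (N * ‖B‖)))) = D * (N ^ 4 * ε * (‖A‖ * ‖B‖)) := by ring
    _ ≤ ((M + 3) * N ^ (c + 2)) * (N ^ 4 * ε * (‖A‖ * ‖B‖)) :=
        mul_le_mul_of_nonneg_right hDN (by positivity)
    _ = _ := by ring

end RectMul

/-! ### Rounding errors of the Householder transformation -/

section Householder

open Filter Topology

theorem bounds_of_abs_sub_le {ε y z : ℝ} (hy : 0 ≤ y) (h : |z - y| ≤ ε * |y|) :
    (1 - ε) * y ≤ z ∧ z ≤ (1 + ε) * y := by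
  rw [abs_of_nonneg hy, abs_le] at h
  constructor <;> linarith

/-- All summands are nonnegative, so there is no cancellation: each square meets one rounding in its
multiplication and at most `n` in the additions, hence the exponent `n + 1`. -/
theorem exec_sumSq_bounds {n : ℕ} {x : Fin n → ℝ} {ε s : ℝ} {t : ℕ} (hε : 0 < ε) (hε1 : ε ≤ 1)
    (h : ((List.finRange n).foldlM (m := Prog ℝ) (fun acc i => do
        let p ← Prog.fmul (x i) (x i)
        Prog.fadd acc p) (0 : ℝ)).Exec ε s t) :
    (1 - ε) ^ (n + 1) * ∑ i, x i ^ 2 ≤ s ∧ s ≤ (1 + ε) ^ (n + 1) * ∑ i, x i ^ 2 := by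
  have key := Exec.foldlM (fun l s _ => 0 ≤ (l.map fun i => x i ^ 2).sum ∧
    (1 - ε) ^ (l.length + 1) * (l.map fun i => x i ^ 2).sum ≤ s ∧
    s ≤ (1 + ε) ^ (l.length + 1) * (l.map fun i => x i ^ 2).sum) ?_ (by simp) h
  · simpa [List.sum_ofFn, ← List.ofFn_eq_map] using key.2
  · rintro l i s s' _ _ ⟨h0, h1, h2⟩ hs
    simp only [exec_bind, exec_fmul, exec_fadd] at hs
    obtain ⟨p, _, _, ⟨hp, -⟩, ⟨hs', -⟩, -⟩ := hs
    simp only [List.map_append, List.sum_append, List.map_singleton, List.sum_singleton,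
      List.length_append, List.length_singleton]
    set S := (l.map fun i => x i ^ 2).sum
    obtain ⟨hp1, hp2⟩ := bounds_of_abs_sub_le (mul_self_nonneg (x i)) hp
    have hx : 0 ≤ x i ^ 2 := sq_nonneg _
    have e1 : 0 ≤ 1 - ε := by linarith
    have hlow : (1 - ε) ^ (l.length + 1) * (S + x i ^ 2) ≤ s + p := by
      have : (1 - ε) ^ (l.length + 1) ≤ 1 - ε := pow_le_of_le_one e1 (by linarith) (by omega)
      nlinarith [mul_le_mul_of_nonneg_right this hx]
    have hup : s + p ≤ (1 + ε) ^ (l.length + 1) * (S + x i ^ 2) := by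
      have : 1 + ε ≤ (1 + ε) ^ (l.length + 1) := le_self_pow₀ (by linarith) (by omega)
      nlinarith [mul_le_mul_of_nonneg_right this hx]
    have hsp : 0 ≤ s + p := le_trans (by positivity) hlow
    obtain ⟨hs1, hs2⟩ := bounds_of_abs_sub_le hsp hs'
    refine ⟨by positivity, le_trans ?_ hs1, hs2.trans ?_⟩
    · rw [pow_succ', mul_assoc]
      exact mul_le_mul_of_nonneg_left hlow e1
    · rw [pow_succ' _ (l.length + 1), mul_assoc]
      exact mul_le_mul_of_nonneg_left hup (by linarith)

/-- The `n + 1` roundings of the sum of squares contribute at most `2 (N + 1) ε`, and the remaining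
`2 ε` pays for rounding the square root together with the cross term. -/
theorem exec_vecLength_abs_sub_le {n N : ℕ} {x : Fin n → ℝ} {ε σ : ℝ} {t : ℕ} (hn : n ≤ N)
    (hε : 0 < ε) (hsmall : (2 * N + 4) * ε ≤ 1) (h : (vecLength x).Exec ε σ t) :
    |σ - √(∑ i, x i ^ 2)| ≤ (2 * N + 4) * ε * √(∑ i, x i ^ 2) := by
  obtain ⟨⟨s, u, hs, hσ⟩, -⟩ := exec_vecLength h
  have hN0 : (0 : ℝ) ≤ N := Nat.cast_nonneg _
  have hn' : (n : ℝ) ≤ N := by exact_mod_cast hn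
  have hε1 : ε ≤ 1 / 4 := by nlinarith [mul_nonneg hN0 hε.le]
  obtain ⟨hs1, hs2⟩ := exec_sumSq_bounds hε (by linarith) hs
  set S := ∑ i, x i ^ 2
  have hS : 0 ≤ S := Finset.sum_nonneg fun _ _ => sq_nonneg _
  set m := (n + 1 : ℕ) with hm
  have hmN : (m : ℝ) ≤ N + 1 := by rw [hm]; push_cast; linarith
  set θ := 2 * (m : ℝ) * ε with hθ
  have hθ0 : 0 ≤ θ := by positivity
  have hθN : θ ≤ (2 * N + 2) * ε := by
    rw [hθ]
    exact mul_le_mul_of_nonneg_right (by linarith) hε.le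
  have hθ1 : θ ≤ 1 := by linarith
  have hlow : 1 - θ ≤ (1 - ε) ^ m := by
    have := one_add_mul_le_pow (a := -ε) (by linarith) m
    rw [← sub_eq_add_neg] at this
    linarith [mul_nonneg (Nat.cast_nonneg m : (0 : ℝ) ≤ m) hε.le]
  -- From `(1 + ε)(1 - ε) ≤ 1` and Bernoulli's inequality, `(1 + ε) ^ m ≤ 1 / (1 - θ / 2)`, which is
  -- at most `1 + θ` as long as `θ ≤ 1`.
  have hup : (1 + ε) ^ m ≤ 1 + θ := by
    have h1 : 1 - θ / 2 ≤ (1 - ε) ^ m := by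
      have := one_add_mul_le_pow (a := -ε) (by linarith) m
      rw [← sub_eq_add_neg] at this
      linarith
    have h2 : (1 + ε) ^ m * (1 - ε) ^ m ≤ 1 := by
      rw [← mul_pow]
      exact pow_le_one₀ (by nlinarith) (by nlinarith)
    have h3 : 0 ≤ (1 + ε) ^ m := by positivity
    have h4 : (1 + ε) ^ m * (1 - θ / 2) ≤ 1 := (mul_le_mul_of_nonneg_left h1 h3).trans h2
    nlinarith
  have hr : 0 ≤ √S := Real.sqrt_nonneg S
  have hrr : √S ^ 2 = S := Real.sq_sqrt hS
  have hs1' : (1 - θ) * S ≤ s := (mul_le_mul_of_nonneg_right hlow hS).trans hs1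
  have hs2' : s ≤ (1 + θ) * S := hs2.trans (mul_le_mul_of_nonneg_right hup hS)
  have r1 : (1 - θ) * √S ≤ √s := by
    apply Real.le_sqrt_of_sq_le
    rw [mul_pow, hrr]
    refine le_trans ?_ hs1'
    exact mul_le_mul_of_nonneg_right (by nlinarith) hS
  have r2 : √s ≤ (1 + θ) * √S := by
    rw [Real.sqrt_le_left (by positivity), mul_pow, hrr]
    refine hs2'.trans ?_
    exact mul_le_mul_of_nonneg_right (by nlinarith) hS
  obtain ⟨t1, t2⟩ := bounds_of_abs_sub_le (Real.sqrt_nonneg s) hσ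
  rw [abs_le]
  constructor
  · have : (1 - ε) * ((1 - θ) * √S) ≤ σ :=
      (mul_le_mul_of_nonneg_left r1 (by linarith)).trans t1
    have h5 : 1 - (2 * N + 4) * ε ≤ (1 - ε) * (1 - θ) := by nlinarith
    nlinarith [mul_le_mul_of_nonneg_right h5 hr]
  · have : σ ≤ (1 + ε) * ((1 + θ) * √S) :=
      t2.trans (mul_le_mul_of_nonneg_left r2 (by linarith))
    have h5 : (1 + ε) * (1 + θ) ≤ 1 + (2 * N + 4) * ε := by nlinarith
    nlinarith [mul_le_mul_of_nonneg_right h5 hr]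

/-- The exact Householder vector. -/
theorem exists_householder_vector {n : ℕ} (hn : 0 < n) (x : Fin n → ℝ) {g : ℝ} (hg : g ^ 2 = 1)
    (hgx : g * x ⟨0, hn⟩ = -|x ⟨0, hn⟩|) (hs : 0 < √(∑ i, x i ^ 2)) :
    ∃ (v : Fin n → ℝ) (T : ℝ), √(∑ i, x i ^ 2) ≤ T ∧ ∑ i, v i ^ 2 = T ^ 2 ∧
      (∀ i, v i = if i = ⟨0, hn⟩ then x ⟨0, hn⟩ - g * √(∑ i, x i ^ 2) else x i) ∧
      2 * ∑ i, v i * x i = T ^ 2 := by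
  set s := √(∑ i, x i ^ 2) with hsdef
  set f : Fin n := ⟨0, hn⟩
  have hss : s ^ 2 = ∑ i, x i ^ 2 := Real.sq_sqrt (Finset.sum_nonneg fun _ _ => sq_nonneg _)
  have hT0 : 0 ≤ 2 * s ^ 2 + 2 * s * |x f| := by positivity
  have hv : ∀ i, (if i = f then x f - g * s else x i) = x i - if i = f then g * s else 0 := by
    intro i
    split_ifs with h
    · rw [h]
    · ring
  -- Since `g * x f = -|x f|`, the terms of `‖v‖² = 2 s² + 2 s |x f|` do not cancel. This yields `s
  -- ≤ T`, so errors relative to `s` are also errors relative to `T`.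
  refine ⟨fun i => if i = f then x f - g * s else x i, √(2 * s ^ 2 + 2 * s * |x f|),
    ?_, ?_, fun i => rfl, ?_⟩
  · apply Real.le_sqrt_of_sq_le
    have : 0 ≤ s * |x f| := by positivity
    nlinarith [sq_nonneg s]
  · rw [Real.sq_sqrt hT0]
    simp only [hv, sub_sq, Finset.sum_add_distrib, Finset.sum_sub_distrib, ← hss]
    simp
    linear_combination (-2 * s) * hgx + s ^ 2 * hg
  · rw [Real.sq_sqrt hT0]
    simp only [hv, sub_mul, Finset.sum_sub_distrib, ← sq, ← hss]
    simp
    linear_combination (-2 * s) * hgx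

theorem abs_entry_le_of_sum_sq {n : ℕ} {v : Fin n → ℝ} {T : ℝ} (hT : 0 ≤ T)
    (h : ∑ i, v i ^ 2 = T ^ 2) (i : Fin n) : |v i| ≤ T := by
  apply abs_le_of_sq_le_sq _ hT
  rw [← h]
  exact Finset.single_le_sum (f := fun i => v i ^ 2) (fun i _ => sq_nonneg _) (Finset.mem_univ i)

theorem sqrt_sum_sq_eq_norm {n : ℕ} (v : Fin n → ℝ) :
    √(∑ i, v i ^ 2) = ‖WithLp.toLp 2 v‖ := by
  rw [EuclideanSpace.norm_eq]
  simp

/-- Reverse triangle inequality for two vectors that differ in a single coordinate. -/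
theorem abs_sqrt_sum_sq_sub_le {n : ℕ} {v v' : Fin n → ℝ} {c : ℝ} (f : Fin n)
    (hf : |v f - v' f| ≤ c) (h : ∀ i, i ≠ f → v i = v' i) :
    |√(∑ i, v i ^ 2) - √(∑ i, v' i ^ 2)| ≤ c := by
  rw [sqrt_sum_sq_eq_norm, sqrt_sum_sq_eq_norm]
  refine (abs_norm_sub_norm_le _ _).trans ?_
  rw [← WithLp.toLp_sub, ← sqrt_sum_sq_eq_norm, Finset.sum_eq_single f]
  · simpa [Real.sqrt_sq_eq_abs] using hf
  · intro i _ hi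
    simp [h i hi]
  · simp

/-- Rounding errors in the formation of a normalised Householder vector; `v` and `T` are the exact
vector and its length, `vc` and `τ` their computed counterparts. -/
theorem normalised_vector_error {η ε T vi vci τ w y : ℝ} (hη : 1000 * η ≤ 1)
    (hε : 0 < ε) (hεη : ε ≤ η) (hT : 0 < T) (hvi : |vi| ≤ T) (hv : |vci - vi| ≤ 4 * η * T)
    (hτ : |τ - T| ≤ 9 * η * T) (hw : |w - vci / τ| ≤ ε * |vci / τ|)
    (hy : |y - 2 * w| ≤ ε * |2 * w|) :
    |w - vi / T| ≤ 53 * η ∧ |y - 2 * (vi / T)| ≤ 110 * η := by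
  have hη0 : 0 < η := hε.trans_le hεη
  have hτ2 : T / 2 ≤ τ := by
    have := (abs_le.1 hτ).1
    nlinarith
  have hτ0 : 0 < τ := by linarith
  have hu : |vi / T| ≤ 1 := by
    rw [abs_div, abs_of_pos hT]
    exact (div_le_one hT).2 hvi
  have hz : |vci / τ - vi / T| ≤ 26 * η := by
    -- Separates the error of the numerator from that of the length; the latter is multiplied by `vi
    -- / T`, which is at most `1` in absolute value.
    have e : vci / τ - vi / T = ((vci - vi) - vi / T * (τ - T)) / τ := by
      field_simp
      ring
    rw [e, abs_div, abs_of_pos hτ0, div_le_iff₀ hτ0]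
    have h1 : |vi / T * (τ - T)| ≤ 9 * η * T := by
      rw [abs_mul]
      nlinarith [abs_nonneg (τ - T)]
    have h2 := abs_sub (vci - vi) (vi / T * (τ - T))
    nlinarith
  set z := vci / τ
  set u := vi / T
  have hz1 : |z| ≤ 1 + 26 * η := by
    have := abs_sub_abs_le_abs_sub z u
    linarith
  have hw' : |w - u| ≤ 53 * η := by
    have h1 : ε * |z| ≤ η * (1 + 26 * η) :=
      mul_le_mul hεη hz1 (abs_nonneg _) hη0.le
    have h2 := abs_sub_le w z u
    nlinarith
  refine ⟨hw', ?_⟩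
  have hw1 : |w| ≤ 1 + 53 * η := by
    have := abs_sub_abs_le_abs_sub w u
    linarith
  rw [abs_mul, abs_two] at hy
  have h1 : ε * (2 * |w|) ≤ η * (2 * (1 + 53 * η)) :=
    mul_le_mul hεη (by linarith) (by positivity) hη0.le
  have h2 := abs_sub_le y (2 * w) (2 * u)
  have h3 : |2 * w - 2 * u| = 2 * |w - u| := by
    rw [← mul_sub, abs_mul, abs_two]
  nlinarith

/-- The computed Householder transformation is close to an exact one. -/
theorem exec_householder_error {n N : ℕ} (hn : 0 < n) (hN : n ≤ N) {x : Fin n → ℝ} {ε η ρ : ℝ}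
    {w y : Fin n → ℝ} {t : ℕ} (hε : 0 < ε) (hη : η = (2 * N + 4) * ε) (hη1 : 1000 * η ≤ 1)
    (h : (householder hn x).Exec ε (ρ, w, y) t) :
    ∃ (u : Fin n → ℝ) (ρ' : ℝ), ∑ i, u i ^ 2 = 1 ∧ (∀ i, |w i - u i| ≤ 53 * η) ∧
      (∀ i, |y i - 2 * u i| ≤ 110 * η) ∧
      (∀ i, x i - u i * (2 * ∑ j, u j * x j) = if i = ⟨0, hn⟩ then ρ' else 0) ∧
      |ρ - ρ'| ≤ 2 * η * √(∑ i, x i ^ 2) := by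
  have hN0 : (0 : ℝ) ≤ N := Nat.cast_nonneg _
  have hεη' : ε ≤ η / 4 := by nlinarith
  have hεη : ε ≤ η := by linarith
  have hη0 : 0 < η := hε.trans_le hεη
  simp only [householder, exec_bind, exec_literal] at h
  obtain ⟨_, _, _, ⟨rfl, rfl⟩, ⟨_, _, _, ⟨rfl, rfl⟩, ⟨_, _, _, ⟨rfl, rfl⟩,
    ⟨σ, _, _, hσ, ⟨nz, _, _, hnz, h, -⟩, -⟩, -⟩, -⟩, -⟩ := h
  have hσ := exec_vecLength_abs_sub_le hN hε (by linarith) hσ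
  rw [← hη] at hσ
  obtain ⟨rfl, -⟩ := exec_isLess.1 hnz
  have hs0 : 0 ≤ √(∑ i, x i ^ 2) := Real.sqrt_nonneg _
  set f : Fin n := ⟨0, hn⟩ with hf
  by_cases hpos : 0 < σ
  · have hs : 0 < √(∑ i, x i ^ 2) := by
      by_contra hneg
      have : √(∑ i, x i ^ 2) = 0 := le_antisymm (not_lt.1 hneg) hs0
      rw [this, mul_zero, sub_zero] at hσ
      exact hpos.ne' (abs_nonpos_iff.1 hσ)
    simp only [hpos, decide_true, if_true, exec_bind] at h
    obtain ⟨neg, _, _, hneg, h, -⟩ := h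
    obtain ⟨rfl, -⟩ := exec_isLess.1 hneg
    set s := √(∑ i, x i ^ 2) with hsdef
    -- Merges the two sign branches: `g = ±1` is the sign of the target entry. Only the branch `g =
    -- -1` incurs a rounding, in the negation of `σ`.
    obtain ⟨ρ₀, g, t', hg, hgx, hρg, h⟩ : ∃ ρ₀ g : ℝ, ∃ t', g ^ 2 = 1 ∧ g * x f = -|x f| ∧
        |ρ₀ - g * s| ≤ 2 * η * s ∧
        (do
          let v₁ ← fsub (x f) ρ₀
          let τ ← vecLength fun i => if i = f then v₁ else x i
          let w ← tabulate fun i => fdiv (if i = f then v₁ else x i) τ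
          let y ← tabulate fun i => fmul 2 (w i)
          pure (ρ₀, w, y) : Prog ℝ _).Exec ε (ρ, w, y) t' := by
      by_cases hx : x f < 0
      · simp only [hx, decide_true, if_true] at h
        rw [exec_bind] at h
        obtain ⟨ρ₀, _, t', hρ, h, -⟩ := h
        obtain ⟨rfl, -⟩ := exec_pure.1 hρ
        refine ⟨ρ₀, 1, t', by norm_num, by rw [abs_of_neg hx]; ring, ?_, h⟩
        rw [one_mul]
        nlinarith
      · simp only [hx, decide_false, Bool.false_eq_true, if_false] at h
        rw [exec_bind] at h
        obtain ⟨ρ₀, _, t', hρ, h, -⟩ := h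
        refine ⟨ρ₀, -1, t', by norm_num, by rw [abs_of_nonneg (not_lt.1 hx)]; ring, ?_, h⟩
        obtain ⟨hρ, -⟩ := exec_fsub.1 hρ
        rw [zero_sub, abs_neg, abs_of_pos hpos] at hρ
        have h1 : ρ₀ - -1 * s = (ρ₀ - -σ) - (σ - s) := by ring
        rw [h1]
        refine (abs_sub _ _).trans ?_
        have h2 : σ ≤ 2 * s := by nlinarith [(abs_le.1 hσ).2]
        have h3 : ε * σ ≤ η / 4 * (2 * s) := mul_le_mul hεη' h2 hpos.le (by linarith)
        nlinarith
    simp only [exec_bind, exec_pure] at h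
    obtain ⟨v₁, _, _, hv₁, ⟨τ, _, _, hτ, ⟨w', _, _, hw, ⟨y', _, _, hy, ⟨hout, rfl⟩, -⟩, -⟩, -⟩, -⟩
      := h
    simp only [Prod.mk.injEq] at hout
    obtain ⟨rfl, rfl, rfl⟩ := hout
    obtain ⟨hv₁, -⟩ := exec_fsub.1 hv₁
    obtain ⟨_, hw, -⟩ := hw.tabulate
    obtain ⟨_, hy, -⟩ := hy.tabulate
    simp only [exec_fdiv] at hw
    simp only [exec_fmul] at hy
    have hτ := exec_vecLength_abs_sub_le hN hε (by linarith) hτ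
    rw [← hη] at hτ
    obtain ⟨v, T, hsT, hvT, hv, hvx⟩ := exists_householder_vector hn x hg hgx hs
    rw [← hsdef] at hsT hv
    have hT : 0 < T := hs.trans_le hsT
    have hηT : 0 < η * T := by positivity
    have hηηT : η * (η * T) ≤ η * T / 1000 := by nlinarith
    have hvf : |v₁ - v f| ≤ 4 * η * T := by
      have hvf : v f = x f - g * s := by rw [hv]; simp [hf]
      have h1 : |v f| ≤ T := abs_entry_le_of_sum_sq hT.le hvT f
      have h2 : |x f - ρ - v f| ≤ 2 * η * T := by
        rw [hvf]
        have : x f - ρ - (x f - g * s) = -(ρ - g * s) := by ring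
        rw [this, abs_neg]
        nlinarith
      have h3 : |x f - ρ| ≤ T + 2 * η * T := by
        have := abs_sub_abs_le_abs_sub (x f - ρ) (v f)
        linarith
      have h4 : ε * |x f - ρ| ≤ η / 4 * (T + 2 * η * T) :=
        mul_le_mul hεη' h3 (abs_nonneg _) (by linarith)
      have h5 := abs_sub_le v₁ (x f - ρ) (v f)
      nlinarith
    set vc : Fin n → ℝ := fun i => if i = f then v₁ else x i with hvc
    have hvcv : ∀ i, i ≠ f → vc i = v i := fun i hi => by
      rw [hv]
      simp only [hvc, if_neg hi]
      exact (if_neg hi).symm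
    have hτT : |τ - T| ≤ 9 * η * T := by
      have h1 : |√(∑ i, vc i ^ 2) - √(∑ i, v i ^ 2)| ≤ 4 * η * T :=
        abs_sqrt_sum_sq_sub_le f (by simpa [hvc] using hvf) hvcv
      rw [hvT, Real.sqrt_sq hT.le] at h1
      have h2 : √(∑ i, vc i ^ 2) ≤ T + 4 * η * T := by linarith [(abs_le.1 h1).2]
      have h3 := mul_le_mul_of_nonneg_left h2 hη0.le
      have h4 := abs_sub_le τ (√(∑ i, vc i ^ 2)) T
      nlinarith
    have key : ∀ i, |w i - v i / T| ≤ 53 * η ∧ |y i - 2 * (v i / T)| ≤ 110 * η := fun i => by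
      refine normalised_vector_error hη1 hε hεη hT (abs_entry_le_of_sum_sq hT.le hvT i) ?_ hτT
        (hw i).1 (hy i).1
      by_cases hi : i = f
      · rw [hi]
        simpa [hvc] using hvf
      · have := hvcv i hi
        simp only [hvc] at this
        rw [this, sub_self, abs_zero]
        positivity
    refine ⟨fun i => v i / T, g * s, ?_, fun i => (key i).1, fun i => (key i).2, fun i => ?_, hρg⟩
    · simp only [div_pow, ← Finset.sum_div, hvT]
      exact div_self (by positivity)
    · have h1 : ∑ j, v j / T * x j = T / 2 := by
        simp only [div_mul_eq_mul_div, ← Finset.sum_div]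
        rw [div_eq_iff hT.ne']
        linarith
      have h2 : v i / T * (2 * (T / 2)) = v i := by
        field_simp
      rw [h1, h2, hv]
      split_ifs with hi
      · rw [hi]; ring
      · ring
  -- The relative error of `σ` is less than `1`, so a nonpositive `σ` forces the vector to be
  -- exactly zero, and the returned reflection is then exact.
  · have hs : √(∑ i, x i ^ 2) = 0 := by
      have := (abs_le.1 hσ).1
      nlinarith
    have hx : ∀ i, x i = 0 := fun i => by
      have h1 := Real.sq_sqrt (Finset.sum_nonneg fun i (_ : i ∈ Finset.univ) => sq_nonneg (x i))
      rw [hs] at h1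
      exact abs_nonpos_iff.1 (abs_entry_le_of_sum_sq le_rfl h1.symm i)
    simp only [hpos, decide_false, Bool.false_eq_true, if_false, exec_pure, Prod.mk.injEq] at h
    obtain ⟨⟨rfl, rfl, rfl⟩, -⟩ := h
    refine ⟨fun i => if i = f then 1 else 0, 0, by simp, fun i => ?_, fun i => ?_, fun i => ?_, ?_⟩
    · simp
      positivity
    · simp
      positivity
    · simp [hx]
    · rw [hs]
      simp

end Householder

/-! ### Backward stability -/

section Stability

open Filter Topology

/-- `(R, W, Y)` is an approximate QR decomposition of `A`: the matrix `1 - W * Y` is within `q` of an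
orthogonal matrix that maps a matrix within `a * ‖A‖` of `A` to `[R; 0]`. -/
def IsApproxQR {n m : ℕ} (A : Matrix (Fin n) (Fin m) ℝ) (R : Matrix (Fin m) (Fin m) ℝ)
    (W : Matrix (Fin n) (Fin m) ℝ) (Y : Matrix (Fin m) (Fin n) ℝ) (q a : ℝ) : Prop :=
  (∀ i j, j < i → R i j = 0) ∧ ‖W‖ ≤ 3 * m - 1 ∧ ‖Y‖ ≤ 3 * m ∧
    ∃ (Q : Matrix (Fin n) (Fin n) ℝ) (δA : Matrix (Fin n) (Fin m) ℝ),
      Q ∈ Matrix.orthogonalGroup (Fin n) ℝ ∧ ‖Q - (1 - W * Y)‖ ≤ q ∧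
      Q * (A + δA) = vcat R 0 ∧ ‖δA‖ ≤ a * ‖A‖

/-! ### Block identities and the inductive step for approximate QR decompositions -/

theorem topEmb_mul_topEmb {n m l : ℕ} (h : m ≤ n) (hl : l ≤ m) :
    topEmb h * topEmb hl = topEmb (hl.trans h) := by
  rw [← leftCols_eq]
  rfl

/-- Both sides select the coordinates from `l` to `m` of `Fin n`. This is how the factor `RR` of the
trailing block finds its place among the first `m` rows. -/
theorem botEmb_mul_topEmb {n m l : ℕ} (h : m ≤ n) (hl : l ≤ m) :
    botEmb (hl.trans h) * topEmb (Nat.sub_le_sub_right h l) = topEmb h * botEmb hl := by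
  rw [← leftCols_eq, ← rightCols_eq]
  rfl

theorem vcat_zero_eq {n m q : ℕ} (h : m ≤ n) (R : Matrix (Fin m) (Fin q) ℝ) :
    (vcat R 0 : Matrix (Fin n) (Fin q) ℝ) = topEmb h * R := by
  rw [vcat_eq h, Matrix.mul_zero, add_zero]

section

variable {n l r : ℕ} (h : l ≤ n)

theorem topEmb_transpose_mul_topEmb_mul (X : Matrix (Fin l) (Fin r) ℝ) :
    (topEmb h).transpose * (topEmb h * X) = X := by
  rw [← Matrix.mul_assoc, topEmb_transpose_mul_topEmb, Matrix.one_mul]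

theorem botEmb_transpose_mul_botEmb_mul (X : Matrix (Fin (n - l)) (Fin r) ℝ) :
    (botEmb h).transpose * (botEmb h * X) = X := by
  rw [← Matrix.mul_assoc, botEmb_transpose_mul_botEmb, Matrix.one_mul]

theorem topEmb_transpose_mul_botEmb_mul (X : Matrix (Fin (n - l)) (Fin r) ℝ) :
    (topEmb h).transpose * (botEmb h * X) = 0 := by
  rw [← Matrix.mul_assoc, topEmb_transpose_mul_botEmb, Matrix.zero_mul]

theorem botEmb_transpose_mul_topEmb_mul (X : Matrix (Fin l) (Fin r) ℝ) :
    (botEmb h).transpose * (topEmb h * X) = 0 := by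
  rw [← Matrix.mul_assoc, botEmb_transpose_mul_topEmb, Matrix.zero_mul]

theorem topEmb_mul_transpose_mul_add (X : Matrix (Fin n) (Fin r) ℝ) :
    topEmb h * ((topEmb h).transpose * X) + botEmb h * ((botEmb h).transpose * X) = X := by
  rw [← Matrix.mul_assoc, ← Matrix.mul_assoc, ← Matrix.add_mul, topEmb_mul_transpose_add,
    Matrix.one_mul]

end

/-- The block diagonal matrix with blocks `1` and `Q`. -/
theorem extend_orthogonal {n l : ℕ} (h : l ≤ n) {Q : Matrix (Fin (n - l)) (Fin (n - l)) ℝ}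
    (hQ : Q ∈ Matrix.orthogonalGroup (Fin (n - l)) ℝ) :
    topEmb h * (topEmb h).transpose + botEmb h * Q * (botEmb h).transpose ∈
      Matrix.orthogonalGroup (Fin n) ℝ := by
  rw [Matrix.mem_orthogonalGroup_iff'] at hQ ⊢
  have h5 : ∀ X : Matrix (Fin (n - l)) (Fin n) ℝ, Q.transpose * (Q * X) = X := fun X => by
    rw [← Matrix.mul_assoc, hQ, Matrix.one_mul]
  simp only [Matrix.transpose_add, Matrix.transpose_mul, Matrix.transpose_transpose,
    Matrix.add_mul, Matrix.mul_add, Matrix.mul_assoc, h5, Matrix.mul_zero,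
    topEmb_transpose_mul_topEmb_mul, botEmb_transpose_mul_botEmb_mul,
    topEmb_transpose_mul_botEmb_mul, botEmb_transpose_mul_topEmb_mul, add_zero, zero_add]
  exact topEmb_mul_transpose_add h

/-- The rounding errors enter only through `e₁` (update of the right half) and `e₂` (formation of
`X`); the rest is exact algebra with `diag(1, QR) * QL` as the orthogonal factor. `hsmall` keeps the
bound on `W` from degrading. -/
theorem isApproxQR_step {n m l : ℕ} (h : m ≤ n) (hl : l ≤ m) (hn : l ≤ n)
    {A : Matrix (Fin n) (Fin m) ℝ} {RL : Matrix (Fin l) (Fin l) ℝ}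
    {WL : Matrix (Fin n) (Fin l) ℝ} {YL : Matrix (Fin l) (Fin n) ℝ}
    {AR : Matrix (Fin n) (Fin (m - l)) ℝ} {RR : Matrix (Fin (m - l)) (Fin (m - l)) ℝ}
    {WR : Matrix (Fin (n - l)) (Fin (m - l)) ℝ} {YR : Matrix (Fin (m - l)) (Fin (n - l)) ℝ}
    {XB : Matrix (Fin (n - l)) (Fin l) ℝ} {qL aL qR aR e₁ e₂ : ℝ}
    (hL : IsApproxQR (leftCols hl A) RL WL YL qL aL)
    (hAR : ‖AR - (rightCols hl A - WL * (YL * rightCols hl A))‖ ≤ e₁ * ‖rightCols hl A‖)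
    (hR : IsApproxQR (bottomRows hn AR) RR WR YR qR aR)
    (hXB : ‖XB - (bottomRows hn WL - WR * (YR * bottomRows hn WL))‖ ≤ e₂)
    (he₁ : 0 ≤ e₁) (haL : 0 ≤ aL) (haR : 0 ≤ aR) (hsmall : qR * (3 * l) + e₂ ≤ 1) :
    IsApproxQR A (vcat (hcat RL (topRows hn AR)) (hcat (constMat _ _ 0) RR))
      (hcat (vcat (topRows hn WL) XB) (vcat (constMat _ _ 0) WR))
      (vcat YL (hcat (constMat _ _ 0) YR))
      (qL + qR + qR * qL + e₂ * (3 * l)) (aL + (e₁ + qL) + aR * (1 + (e₁ + qL))) := by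
  obtain ⟨hRL, hWL, hYL, QL, δ₁, hQL, hΔL, hQLA, hδ₁⟩ := hL
  obtain ⟨hRR, hWR, hYR, QR, δ₃, hQR, hΔR, hQRA, hδ₃⟩ := hR
  have hqL : 0 ≤ qL := (norm_nonneg _).trans hΔL
  have hqR : 0 ≤ qR := (norm_nonneg _).trans hΔR
  have he₂ : 0 ≤ e₂ := (norm_nonneg _).trans hXB
  have hQb := extend_orthogonal hn hQR
  have hupper : ∀ i j, j < i →
      (vcat (hcat RL (topRows hn AR)) (hcat (constMat _ _ 0) RR) : Matrix (Fin m) (Fin m) ℝ) i j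
        = 0 := by
    intro i j hij
    simp only [vcat, Matrix.of_apply]
    obtain ⟨i, rfl⟩ | ⟨i, rfl⟩ := castLE_or_upperIdx hl i <;> rw [Fin.lt_def] at hij <;>
      obtain ⟨j, rfl⟩ | ⟨j, rfl⟩ := castLE_or_upperIdx hl j
    · rw [glue_castLE]
      simp only [hcat, Matrix.of_apply, glue_castLE]
      exact hRL i j hij
    · exfalso
      simp only [upperIdx, Fin.val_castLE] at hij
      omega
    · rw [glue_upperIdx]
      simp only [hcat, Matrix.of_apply, glue_castLE]
      rfl
    · rw [glue_upperIdx]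
      simp only [hcat, Matrix.of_apply, glue_upperIdx]
      simp only [upperIdx] at hij
      exact hRR i j (by rw [Fin.lt_def]; omega)
  rw [leftCols_eq] at hQLA hδ₁
  rw [rightCols_eq] at hAR
  rw [bottomRows_eq] at hQRA hδ₃ hXB
  rw [vcat_zero_eq hn] at hQLA
  rw [vcat_zero_eq (Nat.sub_le_sub_right h l)] at hQRA
  refine ⟨hupper, ?_⟩
  simp only [constMat_zero, hcat_eq hl, hcat_eq hn, vcat_eq hl, vcat_eq hn, topRows_eq]
  simp only [Matrix.mul_zero, Matrix.zero_mul, zero_add]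
  set E := XB - ((botEmb hn).transpose * WL - WR * (YR * ((botEmb hn).transpose * WL))) with hE
  set ΔL := QL - (1 - WL * YL) with hΔLdef
  set ΔR := QR - (1 - WR * YR) with hΔRdef
  set Qb := topEmb hn * (topEmb hn).transpose + botEmb hn * QR * (botEmb hn).transpose with hQbdef
  have hQb1 : ‖Qb‖ ≤ 1 := norm_orthogonal_le hQb
  have hQL1 : ‖QL‖ ≤ 1 := norm_orthogonal_le hQL
  have hQLt1 : ‖QL.transpose‖ ≤ 1 := (norm_transpose_eq QL).trans_le hQL1
  have hb := norm_botEmb_le hn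
  have hbt := norm_botEmb_transpose_le hn
  have hs := norm_topEmb_le hl
  have hst := norm_topEmb_transpose_le hl
  have hc := norm_botEmb_le hl
  have hct := norm_botEmb_transpose_le hl
  set X := topEmb hn * ((topEmb hn).transpose * WL) + botEmb hn * XB with hX
  -- the inner reflections
  have hH : ‖botEmb hn * ΔR * (botEmb hn).transpose‖ ≤ qR :=
    (norm_mul_contraction_le hbt _).trans ((norm_contraction_mul_le hb _).trans hΔR)
  have hQbH : Qb - botEmb hn * ΔR * (botEmb hn).transpose =
      1 - botEmb hn * (WR * (YR * (botEmb hn).transpose)) := by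
    rw [← topEmb_mul_transpose_add hn, hQbdef, hΔRdef]
    simp only [Matrix.mul_sub, Matrix.sub_mul, Matrix.mul_one, Matrix.mul_assoc]
    abel
  -- `X` is the computed trailing transformation applied to `WL`, plus the rounding error `E`. Hence
  -- `1 - W * Y` is the product of the two computed transformations minus `botEmb hn * E * YL`.
  have hXH : X = (Qb - botEmb hn * ΔR * (botEmb hn).transpose) * WL + botEmb hn * E := by
    have h1 := eq_sub_of_add_eq (topEmb_mul_transpose_mul_add hn WL)
    rw [hQbH, hX, hE]
    simp only [Matrix.mul_sub, Matrix.sub_mul, Matrix.one_mul, Matrix.mul_assoc]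
    rw [h1]
    abel
  have hWY : (X * (topEmb hl).transpose + botEmb hn * WR * (botEmb hl).transpose) *
      (topEmb hl * YL + botEmb hl * (YR * (botEmb hn).transpose)) =
      X * YL + botEmb hn * (WR * (YR * (botEmb hn).transpose)) := by
    simp only [Matrix.mul_add, Matrix.add_mul, Matrix.mul_assoc, topEmb_transpose_mul_topEmb_mul,
      botEmb_transpose_mul_botEmb_mul, topEmb_transpose_mul_botEmb_mul,
      botEmb_transpose_mul_topEmb_mul, Matrix.mul_zero, add_zero, zero_add]
  have hHn : ‖Qb - botEmb hn * ΔR * (botEmb hn).transpose‖ ≤ 1 + qR :=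
    (norm_sub_le _ _).trans (add_le_add hQb1 hH)
  have hbE : ‖botEmb hn * E‖ ≤ e₂ := (norm_contraction_mul_le hb _).trans hXB
  have hml : ((m - l : ℕ) : ℝ) = m - l := Nat.cast_sub hl
  -- the updated right half
  set δ₂ := QL.transpose * AR - A * botEmb hl with hδ₂def
  have hQLQLt : QL * QL.transpose = 1 := (Matrix.mem_orthogonalGroup_iff _ _).1 hQL
  have hQLtQL : QL.transpose * QL = 1 := (Matrix.mem_orthogonalGroup_iff' _ _).1 hQL
  have hQLδ : QL * (A * botEmb hl + δ₂) = AR := by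
    rw [hδ₂def, add_sub_cancel, ← Matrix.mul_assoc, hQLQLt, Matrix.one_mul]
  have hAs : ‖A * topEmb hl‖ ≤ ‖A‖ := norm_mul_contraction_le hs A
  have hAc : ‖A * botEmb hl‖ ≤ ‖A‖ := norm_mul_contraction_le hc A
  have hδ₂ : ‖δ₂‖ ≤ (e₁ + qL) * ‖A‖ := by
    have h1 : δ₂ = QL.transpose * ((AR - (A * botEmb hl - WL * (YL * (A * botEmb hl)))) -
        ΔL * (A * botEmb hl)) := by
      have h2 : (AR - (A * botEmb hl - WL * (YL * (A * botEmb hl)))) - ΔL * (A * botEmb hl) =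
          AR - QL * (A * botEmb hl) := by
        rw [hΔLdef]
        simp only [Matrix.sub_mul, Matrix.one_mul, Matrix.mul_assoc]
        abel
      rw [h2, Matrix.mul_sub, ← Matrix.mul_assoc _ QL, hQLtQL, Matrix.one_mul]
    rw [h1]
    refine (norm_contraction_mul_le hQLt1 _).trans ((norm_sub_le _ _).trans ?_)
    have h3 : ‖ΔL * (A * botEmb hl)‖ ≤ qL * ‖A‖ := matrix_norm_mul_le_of_le hΔL hAc
    have h4 := mul_le_mul_of_nonneg_left hAc he₁
    linarith
  have hδ₃' : ‖δ₃‖ ≤ aR * (1 + (e₁ + qL)) * ‖A‖ := by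
    have h1 : ‖AR‖ ≤ (1 + (e₁ + qL)) * ‖A‖ := by
      rw [← hQLδ]
      refine (norm_contraction_mul_le hQL1 _).trans ((norm_add_le _ _).trans ?_)
      linarith
    rw [mul_assoc]
    exact hδ₃.trans (mul_le_mul_of_nonneg_left ((norm_contraction_mul_le hbt _).trans h1) haR)
  -- The perturbation `δ₃` of the trailing block arises after `QL` has been applied, so it is
  -- transported back by `QL.transpose`.
  refine ⟨?_, ?_, Qb * QL, δ₁ * (topEmb hl).transpose + δ₂ * (botEmb hl).transpose +
    QL.transpose * (botEmb hn * δ₃) * (botEmb hl).transpose, mul_mem hQb hQL, ?_, ?_, ?_⟩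
  -- Each half brings its own `-1` while the target needs only one; the spare unit absorbs `qR (3 l
  -- - 1) + e₂`.
  · have h1 : ‖X * (topEmb hl).transpose‖ ≤ (1 + qR) * (3 * l - 1) + e₂ := by
      refine (norm_mul_contraction_le hst _).trans ?_
      rw [hXH]
      exact (norm_add_le _ _).trans (add_le_add (matrix_norm_mul_le_of_le hHn hWL) hbE)
    have h2 : ‖botEmb hn * WR * (botEmb hl).transpose‖ ≤ 3 * (m - l : ℕ) - 1 :=
      (norm_mul_contraction_le hct _).trans ((norm_contraction_mul_le hb _).trans hWR)
    refine (norm_add_le _ _).trans ((add_le_add h1 h2).trans ?_)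
    rw [hml]
    linarith
  · have h1 : ‖topEmb hl * YL‖ ≤ 3 * l := (norm_contraction_mul_le hs _).trans hYL
    have h2 : ‖botEmb hl * (YR * (botEmb hn).transpose)‖ ≤ 3 * (m - l : ℕ) :=
      (norm_contraction_mul_le hc _).trans ((norm_mul_contraction_le hbt _).trans hYR)
    refine (norm_add_le _ _).trans ((add_le_add h1 h2).trans ?_)
    rw [hml]
    linarith
  · have h1 : Qb * QL - (1 - (X * YL + botEmb hn * (WR * (YR * (botEmb hn).transpose)))) =
        Qb * ΔL + botEmb hn * ΔR * (botEmb hn).transpose * QL -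
          botEmb hn * ΔR * (botEmb hn).transpose * ΔL + botEmb hn * E * YL := by
      have h2 : 1 - (X * YL + botEmb hn * (WR * (YR * (botEmb hn).transpose))) =
          (Qb - botEmb hn * ΔR * (botEmb hn).transpose) * (QL - ΔL) - botEmb hn * E * YL := by
        rw [sub_add_eq_sub_sub, sub_right_comm, ← hQbH, hXH, hΔLdef]
        simp only [Matrix.mul_sub, Matrix.add_mul, Matrix.mul_one, Matrix.mul_assoc]
        abel
      rw [h2]
      simp only [Matrix.mul_sub, Matrix.sub_mul]
      abel
    rw [hWY, h1]
    have n1 : ‖Qb * ΔL‖ ≤ qL := (norm_contraction_mul_le hQb1 _).trans hΔL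
    have n2 : ‖botEmb hn * ΔR * (botEmb hn).transpose * QL‖ ≤ qR :=
      (norm_mul_contraction_le hQL1 _).trans hH
    have n3 : ‖botEmb hn * ΔR * (botEmb hn).transpose * ΔL‖ ≤ qR * qL :=
      matrix_norm_mul_le_of_le hH hΔL
    have n4 : ‖botEmb hn * E * YL‖ ≤ e₂ * (3 * l) := matrix_norm_mul_le_of_le hbE hYL
    exact (norm_add_le _ _).trans (add_le_add ((norm_sub_le _ _).trans
      (add_le_add ((norm_add_le _ _).trans (add_le_add n1 n2)) n3)) n4)
  · rw [vcat_zero_eq h]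
    have i1 : A = A * topEmb hl * (topEmb hl).transpose + A * botEmb hl * (botEmb hl).transpose := by
      rw [Matrix.mul_assoc, Matrix.mul_assoc, ← Matrix.mul_add, topEmb_mul_transpose_add,
        Matrix.mul_one]
    have i2 : A + (δ₁ * (topEmb hl).transpose + δ₂ * (botEmb hl).transpose +
        QL.transpose * (botEmb hn * δ₃) * (botEmb hl).transpose) =
        (A * topEmb hl + δ₁) * (topEmb hl).transpose + ((A * botEmb hl + δ₂) +
          QL.transpose * (botEmb hn * δ₃)) * (botEmb hl).transpose := by
      nth_rewrite 1 [i1]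
      simp only [Matrix.add_mul]
      abel
    have i3 : QL * (QL.transpose * (botEmb hn * δ₃)) = botEmb hn * δ₃ := by
      rw [← Matrix.mul_assoc, hQLQLt, Matrix.one_mul]
    have i4 : Qb * (topEmb hn * RL) = topEmb hn * RL := by
      simp only [hQbdef, Matrix.add_mul, Matrix.mul_assoc, topEmb_transpose_mul_topEmb_mul,
        botEmb_transpose_mul_topEmb_mul, Matrix.mul_zero, add_zero]
    have i5 : Qb * (AR + botEmb hn * δ₃) = topEmb hn * ((topEmb hn).transpose * AR) +
        botEmb hn * (topEmb (Nat.sub_le_sub_right h l) * RR) := by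
      rw [← hQRA]
      simp only [hQbdef, Matrix.add_mul, Matrix.mul_add, Matrix.mul_assoc,
        topEmb_transpose_mul_botEmb_mul, botEmb_transpose_mul_botEmb_mul, Matrix.mul_zero]
      abel
    have i6 : topEmb hn = topEmb h * topEmb hl := (topEmb_mul_topEmb h hl).symm
    have i7 : botEmb hn * (topEmb (Nat.sub_le_sub_right h l) * RR) =
        topEmb h * (botEmb hl * RR) := by
      rw [← Matrix.mul_assoc, botEmb_mul_topEmb h hl, Matrix.mul_assoc]
    rw [i2, Matrix.mul_assoc Qb QL, Matrix.mul_add QL, ← Matrix.mul_assoc QL,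
      ← Matrix.mul_assoc QL, Matrix.mul_add QL _ (QL.transpose * _), hQLA, hQLδ, i3,
      Matrix.mul_add Qb, ← Matrix.mul_assoc Qb (topEmb hn * RL), ← Matrix.mul_assoc Qb (AR + _), i4, i5, i7]
    nth_rewrite 1 2 [i6]
    simp only [Matrix.add_mul, Matrix.mul_add, Matrix.mul_assoc]
    abel
  · have n1 : ‖δ₁ * (topEmb hl).transpose‖ ≤ aL * ‖A‖ :=
      (norm_mul_contraction_le hst _).trans (hδ₁.trans (mul_le_mul_of_nonneg_left hAs haL))
    have n2 : ‖δ₂ * (botEmb hl).transpose‖ ≤ (e₁ + qL) * ‖A‖ :=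
      (norm_mul_contraction_le hct _).trans hδ₂
    have n3 : ‖QL.transpose * (botEmb hn * δ₃) * (botEmb hl).transpose‖ ≤
        aR * (1 + (e₁ + qL)) * ‖A‖ :=
      (norm_mul_contraction_le hct _).trans ((norm_contraction_mul_le hQLt1 _).trans
        ((norm_contraction_mul_le hb _).trans hδ₃'))
    refine (norm_add_le _ _).trans ((add_le_add ((norm_add_le _ _).trans
      (add_le_add n1 n2)) n3).trans (le_of_eq ?_))
    ring

end Stability

/-! ### Propagation of rounding errors through the recursion -/

section StabilityOfQRR

open Filter Topology

theorem exec_qrr_zero {mm : MatMul} {n : ℕ} {h : 0 ≤ n} {A : Matrix (Fin n) (Fin 0) ℝ} {ε : ℝ}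
    {o} {t : ℕ} (hex : (qrr mm n 0 h A).Exec ε o t) : t = 0 := by
  rw [qrr] at hex
  exact hex.2

theorem exec_qrr_one {mm : MatMul} {n : ℕ} {h : 1 ≤ n} {A : Matrix (Fin n) (Fin 1) ℝ} {ε : ℝ}
    {R : Matrix (Fin 1) (Fin 1) ℝ} {W : Matrix (Fin n) (Fin 1) ℝ} {Y : Matrix (Fin 1) (Fin n) ℝ}
    {t : ℕ} (hex : (qrr mm n 1 h A).Exec ε (R, W, Y) t) :
    ∃ ρ w y, (householder h fun i => A i 0).Exec ε (ρ, w, y) t ∧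
      R = Matrix.of (fun _ _ => ρ) ∧ W = Matrix.of (fun i _ => w i) ∧
      Y = Matrix.of (fun _ j => y j) := by
  rw [qrr, exec_bind] at hex
  obtain ⟨⟨ρ, w, y⟩, s, _, hex, ⟨hout, rfl⟩, rfl⟩ := hex
  simp only [Prod.mk.injEq] at hout
  exact ⟨ρ, w, y, hex, hout⟩

/-- Unfolds one level of the recursion. Keeping `l` abstract spares later arguments the types that
mention `(m + 2) / 2`. -/
theorem exec_qrr_add_two {mm : MatMul} {n m : ℕ} {h : m + 2 ≤ n}
    {A : Matrix (Fin n) (Fin (m + 2)) ℝ} {ε : ℝ}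
    {R : Matrix (Fin (m + 2)) (Fin (m + 2)) ℝ} {W : Matrix (Fin n) (Fin (m + 2)) ℝ}
    {Y : Matrix (Fin (m + 2)) (Fin n) ℝ} {t l : ℕ} (hl : l = (m + 2) / 2) (hlm : l ≤ m + 2)
    (hln : l ≤ n) (hlmn : m + 2 - l ≤ n - l)
    (hex : (qrr mm n (m + 2) h A).Exec ε (R, W, Y) t) :
    ∃ RL WL YL YA WYA AR RR WR YR YW WYW XB, ∃ t₁ t₂ t₃ t₄ t₅ t₆ t₇ t₈ : ℕ,
      (qrr mm n l hln (leftCols hlm A)).Exec ε (RL, WL, YL) t₁ ∧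
      (rectMul mm YL (rightCols hlm A)).Exec ε YA t₂ ∧
      (rectMul mm WL YA).Exec ε WYA t₃ ∧
      (matSub (rightCols hlm A) WYA).Exec ε AR t₄ ∧
      (qrr mm (n - l) (m + 2 - l) hlmn (bottomRows hln AR)).Exec ε (RR, WR, YR) t₅ ∧
      (rectMul mm YR (bottomRows hln WL)).Exec ε YW t₆ ∧
      (rectMul mm WR YW).Exec ε WYW t₇ ∧
      (matSub (bottomRows hln WL) WYW).Exec ε XB t₈ ∧
      R = vcat (hcat RL (topRows hln AR)) (hcat (constMat _ _ 0) RR) ∧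
      W = hcat (vcat (topRows hln WL) XB) (vcat (constMat _ _ 0) WR) ∧
      Y = vcat YL (hcat (constMat _ _ 0) YR) ∧
      t = t₁ + t₂ + t₃ + t₄ + t₅ + t₆ + t₇ + t₈ := by
  subst hl
  rw [qrr] at hex
  simp only [exec_bind, exec_pure, exec_literal] at hex
  obtain ⟨_, _, _, ⟨rfl, rfl⟩, ⟨⟨RL, WL, YL⟩, t₁, _, h₁, ⟨YA, t₂, _, h₂, ⟨WYA, t₃, _, h₃,
    ⟨AR, t₄, _, h₄, ⟨⟨RR, WR, YR⟩, t₅, _, h₅, ⟨YW, t₆, _, h₆, ⟨WYW, t₇, _, h₇, ⟨XB, t₈, _, h₈,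
    ⟨hout, hz⟩, rfl⟩, rfl⟩, rfl⟩, rfl⟩, rfl⟩, rfl⟩, rfl⟩, rfl⟩, rfl⟩ := hex
  simp only [Prod.mk.injEq] at hout
  obtain ⟨rfl, rfl, rfl⟩ := hout
  exact ⟨RL, WL, YL, YA, WYA, AR, RR, WR, YR, YW, WYW, XB, t₁, t₂, t₃, t₄, t₅, t₆, t₇, t₈,
    h₁, h₂, h₃, h₄, h₅, h₆, h₇, h₈, rfl, rfl, rfl, by omega⟩

theorem vcat_of_one {n : ℕ} (hn : 1 ≤ n) (ρ : ℝ) (i : Fin n) (j : Fin 1) :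
    (vcat (Matrix.of fun (_ : Fin 1) (_ : Fin 1) => ρ) 0 : Matrix (Fin n) (Fin 1) ℝ) i j =
      if i = ⟨0, hn⟩ then ρ else 0 := by
  simp [vcat, glue, Fin.ext_iff]

theorem reflection_mem_orthogonalGroup {n : ℕ} {U : Matrix (Fin n) (Fin 1) ℝ}
    (hU : U.transpose * U = 1) :
    1 - U * ((2 : ℝ) • U.transpose) ∈ Matrix.orthogonalGroup (Fin n) ℝ := by
  rw [Matrix.mem_orthogonalGroup_iff']
  have h : ∀ X : Matrix (Fin 1) (Fin n) ℝ, U.transpose * (U * X) = X := fun X => by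
    rw [← Matrix.mul_assoc, hU, Matrix.one_mul]
  simp only [Matrix.transpose_sub, Matrix.transpose_one, Matrix.transpose_mul,
    Matrix.transpose_smul, Matrix.transpose_transpose, Matrix.sub_mul, Matrix.mul_sub,
    Matrix.one_mul, Matrix.mul_one, Matrix.mul_smul, Matrix.smul_mul, Matrix.mul_assoc, h]
  module

/-- Base case: the entrywise errors of `w` and `y` become norm errors at the cost of a factor `N`,
and `269 = 53 * 3 + 110` comes from the product rule for `w i * y j`. -/
theorem isApproxQR_householder {n N : ℕ} (hn : 1 ≤ n) (hN : n ≤ N)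
    {A : Matrix (Fin n) (Fin 1) ℝ} {ε η ρ : ℝ} {w y : Fin n → ℝ} {t : ℕ} (hε : 0 < ε)
    (hη : η = (2 * N + 4) * ε) (hη1 : 1000 * N * η ≤ 1)
    (h : (householder hn fun i => A i 0).Exec ε (ρ, w, y) t) :
    IsApproxQR A (Matrix.of fun _ _ => ρ) (Matrix.of fun i _ => w i) (Matrix.of fun _ j => y j)
      (N * (269 * η)) (2 * η) := by
  have hN1 : (1 : ℝ) ≤ N := by exact_mod_cast hn.trans hN
  have hη0 : 0 < η := by rw [hη]; positivity
  have hNη : η ≤ N * η := le_mul_of_one_le_left hη0.le hN1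
  obtain ⟨u, ρ', hu, hw, hy, hx, hρ⟩ := exec_householder_error hn hN hε hη (by linarith) h
  set U : Matrix (Fin n) (Fin 1) ℝ := Matrix.of fun i _ => u i with hUdef
  have hUU : U.transpose * U = 1 := by
    ext i j
    rw [Subsingleton.elim i j]
    simp [Matrix.mul_apply, hUdef, ← sq, hu]
  have hQ := reflection_mem_orthogonalGroup hUU
  set Q := 1 - U * ((2 : ℝ) • U.transpose) with hQdef
  have hU1 : ‖U‖ ≤ 1 := norm_le_one_of_transpose_mul_self hUU
  have hu1 : ∀ i, |u i| ≤ 1 := abs_entry_le_of_sum_sq zero_le_one (by simpa using hu)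
  have hQA : Q * A = vcat (Matrix.of fun (_ : Fin 1) (_ : Fin 1) => ρ') 0 := by
    ext i j
    rw [vcat_of_one hn, ← hx i, Subsingleton.elim j 0]
    rw [hQdef, Matrix.sub_mul, Matrix.one_mul, Matrix.mul_assoc, Matrix.smul_mul]
    simp [Matrix.mul_apply, hUdef]
    ring
  have hQQ : Q * Q.transpose = 1 := (Matrix.mem_orthogonalGroup_iff _ _).1 hQ
  have hsA : √(∑ i, A i 0 ^ 2) ≤ ‖A‖ := by
    rw [Real.sqrt_le_left (norm_nonneg _)]
    have h1 := abs_entry_le_norm (A.transpose * A) 0 0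
    have h2 : (A.transpose * A) 0 0 = ∑ i, A i 0 ^ 2 := by simp [Matrix.mul_apply, sq]
    rw [h2] at h1
    refine (le_abs_self _).trans (h1.trans ((Matrix.l2_opNorm_mul _ _).trans (le_of_eq ?_)))
    rw [norm_transpose_eq, sq]
  -- The exact reflection `Q` sends `A` to `[ρ'; 0]`. The backward error is the discrepancy with
  -- `[ρ; 0]`, pulled back by `Q.transpose`, so it is bounded by `|ρ - ρ'|`.
  refine ⟨fun i j hij => ?_, ?_, ?_, Q,
    Q.transpose * (vcat (Matrix.of fun (_ : Fin 1) (_ : Fin 1) => ρ) 0 - Q * A), hQ, ?_, ?_, ?_⟩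
  · exact absurd hij (by rw [Subsingleton.elim i j]; exact lt_irrefl _)
  · have h1 : ‖(Matrix.of fun i _ => w i : Matrix (Fin n) (Fin 1) ℝ) - U‖ ≤ N * (53 * η) :=
      norm_le_of_forall_abs_le (by positivity) hN (hn.trans hN) fun i j => hw i
    have h2 := norm_le_norm_add_norm_sub' (Matrix.of fun i _ => w i : Matrix (Fin n) (Fin 1) ℝ) U
    push_cast
    linarith
  · have h1 : ‖(Matrix.of fun _ j => y j : Matrix (Fin 1) (Fin n) ℝ) - (2 : ℝ) • U.transpose‖ ≤
        N * (110 * η) :=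
      norm_le_of_forall_abs_le (by positivity) (hn.trans hN) hN fun i j => hy j
    have h2 := norm_le_norm_add_norm_sub' (Matrix.of fun _ j => y j : Matrix (Fin 1) (Fin n) ℝ)
      ((2 : ℝ) • U.transpose)
    have h3 : ‖(2 : ℝ) • U.transpose‖ ≤ 2 := by
      rw [norm_smul, norm_transpose_eq, Real.norm_two]
      linarith
    push_cast
    linarith
  · refine norm_le_of_forall_abs_le (by positivity) hN hN fun i j => ?_
    have e : (Q - (1 - (Matrix.of fun i _ => w i : Matrix (Fin n) (Fin 1) ℝ) *
        (Matrix.of fun _ j => y j : Matrix (Fin 1) (Fin n) ℝ)) : Matrix (Fin n) (Fin n) ℝ) i j =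
        (w i - u i) * y j + u i * (y j - 2 * u j) := by
      simp [hQdef, Matrix.mul_apply, hUdef]
      ring
    rw [e]
    have hy3 : |y j| ≤ 3 := by
      have h1 := abs_sub_abs_le_abs_sub (y j) (2 * u j)
      have h2 : |2 * u j| ≤ 2 := by
        rw [abs_mul, abs_two]
        linarith [hu1 j]
      linarith [hy j]
    refine (abs_add_le _ _).trans ?_
    rw [abs_mul, abs_mul]
    have h1 : |w i - u i| * |y j| ≤ 53 * η * 3 :=
      mul_le_mul (hw i) hy3 (abs_nonneg _) (by positivity)
    have h2 : |u i| * |y j - 2 * u j| ≤ 1 * (110 * η) :=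
      mul_le_mul (hu1 i) (hy j) (abs_nonneg _) zero_le_one
    linarith
  · rw [Matrix.mul_add, ← Matrix.mul_assoc, hQQ, Matrix.one_mul, add_sub_cancel]
  · have hQt : ‖Q.transpose‖ ≤ 1 := (norm_transpose_eq Q).trans_le (norm_orthogonal_le hQ)
    refine (norm_contraction_mul_le hQt _).trans ?_
    rw [hQA, vcat_zero_eq hn, vcat_zero_eq hn, ← Matrix.mul_sub]
    refine (norm_contraction_mul_le (norm_topEmb_le hn) _).trans ?_
    have h1 := norm_le_of_forall_abs_le (abs_nonneg (ρ - ρ')) (le_refl 1) (le_refl 1)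
      (A := (Matrix.of fun (_ : Fin 1) (_ : Fin 1) => ρ) - Matrix.of fun _ _ => ρ')
      (fun i j => le_rfl)
    rw [Nat.cast_one, one_mul] at h1
    exact h1.trans (hρ.trans (mul_le_mul_of_nonneg_left hsA (by positivity)))

/-- The error of the update `B - W (Y B)`. -/
theorem update_error {mm : MatMul} {N p m q : ℕ} (hN : 1 ≤ N) (hp : p ≤ N) (hm : m ≤ N)
    (hq : q ≤ N) {ε κ : ℝ} (hε : 0 < ε) (hκ : 0 ≤ κ) (hκε : κ * ε ≤ 1)
    (hmm : ∀ p q r : ℕ, p ≤ N → q ≤ N → r ≤ N → ∀ (A : Matrix (Fin p) (Fin q) ℝ)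
        (B : Matrix (Fin q) (Fin r) ℝ) (P : Matrix (Fin p) (Fin r) ℝ) (t : ℕ),
        (rectMul mm A B).Exec ε P t → ‖P - A * B‖ ≤ κ * ε * (‖A‖ * ‖B‖))
    {B WYB Z : Matrix (Fin p) (Fin q) ℝ} {W : Matrix (Fin p) (Fin m) ℝ}
    {Y : Matrix (Fin m) (Fin p) ℝ} {YB : Matrix (Fin m) (Fin q) ℝ} {t₁ t₂ t₃ : ℕ}
    (hW : ‖W‖ ≤ 3 * N) (hY : ‖Y‖ ≤ 3 * N) (h₁ : (rectMul mm Y B).Exec ε YB t₁)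
    (h₂ : (rectMul mm W YB).Exec ε WYB t₂) (h₃ : (matSub B WYB).Exec ε Z t₃) :
    ‖Z - (B - W * (Y * B))‖ ≤ (27 * N ^ 2 * κ + 37 * N ^ 3) * ε * ‖B‖ := by
  have hN1 : (1 : ℝ) ≤ N := by exact_mod_cast hN
  set β := ‖B‖ with hβ
  have hβ0 : 0 ≤ β := norm_nonneg _
  have e1 : ‖YB - Y * B‖ ≤ κ * ε * (3 * N * β) := by
    refine (hmm _ _ _ hm hp hq _ _ _ _ h₁).trans ?_
    exact mul_le_mul_of_nonneg_left (mul_le_mul_of_nonneg_right hY hβ0) (by positivity)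
  have n1 : ‖YB‖ ≤ 6 * N * β := by
    have h1 : ‖Y * B‖ ≤ 3 * N * β := matrix_norm_mul_le_of_le hY le_rfl
    have h2 := norm_le_norm_add_norm_sub' YB (Y * B)
    have h3 : κ * ε * (3 * N * β) ≤ 1 * (3 * N * β) :=
      mul_le_mul_of_nonneg_right hκε (by positivity)
    linarith
  have e2 : ‖WYB - W * YB‖ ≤ κ * ε * (18 * N ^ 2 * β) := by
    refine (hmm _ _ _ hp hm hq _ _ _ _ h₂).trans ?_
    refine mul_le_mul_of_nonneg_left ?_ (by positivity)
    calc ‖W‖ * ‖YB‖ ≤ 3 * N * (6 * N * β) :=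
          mul_le_mul hW n1 (norm_nonneg _) (by positivity)
      _ = _ := by ring
  have e3 : ‖W * (YB - Y * B)‖ ≤ κ * ε * (9 * N ^ 2 * β) := by
    refine (matrix_norm_mul_le_of_le hW e1).trans (le_of_eq ?_)
    ring
  -- The `27` is `18` from the second product and `9` from the first one's error multiplied by `W`.
  -- Below, `37 = 1 + 9 + 27` bounds the matrix `B - WYB` whose rounding remains.
  have e4 : ‖WYB - W * (Y * B)‖ ≤ κ * ε * (27 * N ^ 2 * β) := by
    have : WYB - W * (Y * B) = (WYB - W * YB) + W * (YB - Y * B) := by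
      rw [Matrix.mul_sub]
      abel
    rw [this]
    exact (norm_add_le _ _).trans (by linarith)
  have n2 : ‖W * (Y * B)‖ ≤ 9 * N ^ 2 * β := by
    refine (matrix_norm_mul_le_of_le hW (matrix_norm_mul_le_of_le hY le_rfl)).trans (le_of_eq ?_)
    ring
  have n3 : ‖B - WYB‖ ≤ 37 * N ^ 2 * β := by
    have h2 := norm_le_norm_add_norm_sub' WYB (W * (Y * B))
    have h3 : κ * ε * (27 * N ^ 2 * β) ≤ 1 * (27 * N ^ 2 * β) :=
      mul_le_mul_of_nonneg_right hκε (by positivity)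
    have h4 : β ≤ N ^ 2 * β := le_mul_of_one_le_left hβ0 (one_le_pow₀ hN1)
    exact (norm_sub_le _ _).trans (by linarith)
  have e5 : ‖Z - (B - WYB)‖ ≤ N * ε * (37 * N ^ 2 * β) :=
    (norm_sub_le_of_entrywise hε.le hp hq (exec_matSub h₃).1).trans
      (mul_le_mul_of_nonneg_left n3 (by positivity))
  have : Z - (B - W * (Y * B)) = (Z - (B - WYB)) - (WYB - W * (Y * B)) := by abel
  rw [this]
  refine (norm_sub_le _ _).trans ((add_le_add e5 e4).trans (le_of_eq ?_))
  ring

theorem IsApproxQR.mono {n m : ℕ} {A : Matrix (Fin n) (Fin m) ℝ} {R : Matrix (Fin m) (Fin m) ℝ}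
    {W : Matrix (Fin n) (Fin m) ℝ} {Y : Matrix (Fin m) (Fin n) ℝ} {q a q' a' : ℝ}
    (h : IsApproxQR A R W Y q a) (hq : q ≤ q') (ha : a ≤ a') : IsApproxQR A R W Y q' a' := by
  obtain ⟨hR, hW, hY, Q, δA, hQ, hQW, hQA, hδA⟩ := h
  exact ⟨hR, hW, hY, Q, δA, hQ, hQW.trans hq, hQA,
    hδA.trans (mul_le_mul_of_nonneg_right ha (norm_nonneg _))⟩

/-- Since `(2 l - 1) + (2 r - 1) = (2 m - 1) - 1` for `l + r = m`, one unit `B ε` (or `B' ε`) is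
left over at each inner node. `B` must cover the base case and `9 N² G`, the error of `X` times
`YL`; `B'` must cover `G + 2 N B`, the update error plus the deviation of the left factor from
orthogonality. The `1` in each pays for products of two errors. -/
theorem isApproxQR_of_exec {mm : MatMul} {N : ℕ} (hN : 1 ≤ N) {ε κ G B B' : ℝ} (hε : 0 < ε)
    (hκ : 0 ≤ κ)
    (hmm : ∀ p q r : ℕ, p ≤ N → q ≤ N → r ≤ N → ∀ (A : Matrix (Fin p) (Fin q) ℝ)
        (B : Matrix (Fin q) (Fin r) ℝ) (P : Matrix (Fin p) (Fin r) ℝ) (t : ℕ),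
        (rectMul mm A B).Exec ε P t → ‖P - A * B‖ ≤ κ * ε * (‖A‖ * ‖B‖))
    (hG : G = 27 * N ^ 2 * κ + 37 * N ^ 3) (hB : B = 9 * N ^ 2 * G + 1614 * N ^ 2 + 1)
    (hB' : B' = G + 2 * N * B + 1) (s₁ : κ * ε ≤ 1) (s₂ : 4 * N ^ 2 * B ^ 2 * ε ≤ 1)
    (s₃ : 2 * N * B' ^ 2 * ε ≤ 1) (s₄ : (6 * N ^ 2 * B + 3 * N * G) * ε ≤ 1)
    (s₅ : 1000 * N * (2 * N + 4) * ε ≤ 1) (m n : ℕ) (hm : 1 ≤ m) (h : m ≤ n) (hnN : n ≤ N)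
    (A : Matrix (Fin n) (Fin m) ℝ) (R : Matrix (Fin m) (Fin m) ℝ) (W : Matrix (Fin n) (Fin m) ℝ)
    (Y : Matrix (Fin m) (Fin n) ℝ) (t : ℕ) (hex : (qrr mm n m h A).Exec ε (R, W, Y) t) :
    IsApproxQR A R W Y ((2 * m - 1) * (B * ε)) ((2 * m - 1) * (B' * ε)) := by
  have hN1 : (1 : ℝ) ≤ N := by exact_mod_cast hN
  have hG0 : 0 ≤ G := by rw [hG]; positivity
  have hB0 : 0 ≤ B := by rw [hB]; positivity
  have hB'0 : 0 ≤ B' := by rw [hB']; positivity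
  induction m using Nat.strong_induction_on generalizing n t with
  | _ m ih =>
  match m, hm with
  | 1, _ =>
    obtain ⟨ρ, w, y, hex', rfl, rfl, rfl⟩ := exec_qrr_one hex
    refine (isApproxQR_householder h hnN hε rfl (by linarith) hex').mono ?_ ?_
    · have h1 : N * (269 * (2 * (N : ℝ) + 4)) ≤ B := by
        rw [hB]
        nlinarith [mul_nonneg (sq_nonneg (N : ℝ)) hG0]
      have := mul_le_mul_of_nonneg_right h1 hε.le
      push_cast
      linarith
    · have h1 : 2 * (2 * (N : ℝ) + 4) ≤ B' := by
        have h2 : 12 ≤ B := by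
          rw [hB]
          nlinarith [mul_nonneg (sq_nonneg (N : ℝ)) hG0]
        rw [hB']
        nlinarith
      have := mul_le_mul_of_nonneg_right h1 hε.le
      push_cast
      linarith
  | m + 2, _ =>
    obtain ⟨l, hl⟩ : ∃ l, l = (m + 2) / 2 := ⟨_, rfl⟩
    have hlm : l ≤ m + 2 := by omega
    have hln : l ≤ n := hlm.trans h
    have hlmn : m + 2 - l ≤ n - l := by omega
    obtain ⟨RL, WL, YL, YA, WYA, AR, RR, WR, YR, YW, WYW, XB, t₁, t₂, t₃, t₄, t₅, t₆, t₇, t₈, h₁,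
      h₂, h₃, h₄, h₅, h₆, h₇, h₈, rfl, rfl, rfl, -⟩ := exec_qrr_add_two hl hlm hln hlmn hex
    have hL := ih l (by omega) n (by omega) hln hnN _ _ _ _ _ h₁
    have hR := ih (m + 2 - l) (by omega) (n - l) (by omega) hlmn (by omega) _ _ _ _ _ h₅
    have hmN : ((m + 2 : ℕ) : ℝ) ≤ N := by exact_mod_cast h.trans hnN
    have hl1 : (1 : ℝ) ≤ l := by
      have : 1 ≤ l := by omega
      exact_mod_cast this
    have hml : ((m + 2 - l : ℕ) : ℝ) = (m + 2 : ℕ) - l := Nat.cast_sub hlm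
    have hr1 : (1 : ℝ) ≤ (m + 2 - l : ℕ) := by
      have : 1 ≤ m + 2 - l := by omega
      exact_mod_cast this
    set r : ℝ := ((m + 2 - l : ℕ) : ℝ) with hr
    have hlN : (l : ℝ) ≤ N := by linarith
    have hrN : r ≤ N := by linarith
    have hWL : ‖WL‖ ≤ 3 * N := hL.2.1.trans (by linarith)
    have hYL : ‖YL‖ ≤ 3 * N := hL.2.2.1.trans (by linarith)
    have hWR : ‖WR‖ ≤ 3 * N := hR.2.1.trans (by linarith)
    have hYR : ‖YR‖ ≤ 3 * N := hR.2.2.1.trans (by linarith)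
    have u₁ := update_error hN hnN (by omega) (by omega) hε hκ s₁ hmm hWL hYL h₂ h₃ h₄
    have u₂ := update_error hN (by omega) (by omega) (by omega) hε hκ s₁ hmm hWR hYR h₆ h₇ h₈
    rw [← hG] at u₁ u₂
    have hbWL : ‖bottomRows hln WL‖ ≤ 3 * N := by
      rw [bottomRows_eq]
      exact (norm_contraction_mul_le (norm_botEmb_transpose_le hln) _).trans hWL
    have u₃ := u₂.trans (mul_le_mul_of_nonneg_left hbWL (by positivity))
    have hBε : 0 ≤ B * ε := by positivity
    have hB'ε : 0 ≤ B' * ε := by positivity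
    have hqL : (2 * (l : ℝ) - 1) * (B * ε) ≤ 2 * N * (B * ε) :=
      mul_le_mul_of_nonneg_right (by linarith) hBε
    have hqR : (2 * r - 1) * (B * ε) ≤ 2 * N * (B * ε) :=
      mul_le_mul_of_nonneg_right (by linarith) hBε
    have haR : (2 * r - 1) * (B' * ε) ≤ 2 * N * (B' * ε) :=
      mul_le_mul_of_nonneg_right (by linarith) hB'ε
    have hqL0 : 0 ≤ (2 * (l : ℝ) - 1) * (B * ε) := mul_nonneg (by linarith) hBε
    have hqR0 : 0 ≤ (2 * r - 1) * (B * ε) := mul_nonneg (by linarith) hBε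
    have haR0 : 0 ≤ (2 * r - 1) * (B' * ε) := mul_nonneg (by linarith) hB'ε
    have h3l : G * ε * (3 * N) * (3 * l) ≤ 9 * N ^ 2 * G * ε := by
      calc G * ε * (3 * N) * (3 * l) ≤ G * ε * (3 * N) * (3 * N) :=
            mul_le_mul_of_nonneg_left (by linarith) (by positivity)
        _ = _ := by ring
    refine (isApproxQR_step h hlm hln hL u₁ hR u₃ (by positivity)
      (mul_nonneg (by linarith) hB'ε) haR0 ?_).mono ?_ ?_
    · have : (2 * r - 1) * (B * ε) * (3 * l) ≤ 2 * N * (B * ε) * (3 * N) :=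
        mul_le_mul hqR (by linarith) (by positivity) (by positivity)
      linarith
    · have h4 : (2 * r - 1) * (B * ε) * ((2 * l - 1) * (B * ε)) ≤ ε := by
        calc (2 * r - 1) * (B * ε) * ((2 * l - 1) * (B * ε)) ≤ 2 * N * (B * ε) * (2 * N * (B * ε)) :=
              mul_le_mul hqR hqL hqL0 (by positivity)
          _ = (4 * N ^ 2 * B ^ 2 * ε) * ε := by ring
          _ ≤ 1 * ε := mul_le_mul_of_nonneg_right s₂ hε.le
          _ = ε := one_mul ε
      have h5 : 9 * N ^ 2 * G * ε + ε ≤ B * ε := by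
        have : 9 * N ^ 2 * G + 1 ≤ B := by
          rw [hB]
          linarith [sq_nonneg (N : ℝ)]
        have := mul_le_mul_of_nonneg_right this hε.le
        linarith
      rw [hml] at h4 ⊢
      linarith
    · have h4 : G * ε + (2 * l - 1) * (B * ε) ≤ (B' - 1) * ε := by
        rw [hB']
        linarith
      have h5 : (2 * r - 1) * (B' * ε) * (G * ε + (2 * l - 1) * (B * ε)) ≤ ε := by
        calc (2 * r - 1) * (B' * ε) * (G * ε + (2 * l - 1) * (B * ε))
            ≤ 2 * N * (B' * ε) * (B' * ε) :=
              mul_le_mul haR (by linarith) (by positivity) (by positivity)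
          _ = (2 * N * B' ^ 2 * ε) * ε := by ring
          _ ≤ 1 * ε := mul_le_mul_of_nonneg_right s₃ hε.le
          _ = ε := one_mul ε
      rw [hml] at h5 ⊢
      linarith

theorem eventually_isApproxQR {mm : MatMul} (hmm : mm.IsStable) :
    ∃ (K : ℝ) (c : ℕ), 0 ≤ K ∧ ∀ n : ℕ, 1 ≤ n → ∀ᶠ ε in 𝓝[>] (0 : ℝ), ∀ m : ℕ, 1 ≤ m →
      ∀ (h : m ≤ n) (A : Matrix (Fin n) (Fin m) ℝ) (R : Matrix (Fin m) (Fin m) ℝ)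
        (W : Matrix (Fin n) (Fin m) ℝ) (Y : Matrix (Fin m) (Fin n) ℝ) (t : ℕ),
        (qrr mm n m h A).Exec ε (R, W, Y) t →
          IsApproxQR A R W Y (K * n ^ c * ε) (K * n ^ c * ε) := by
  obtain ⟨D, d, hD, hrect⟩ := eventually_rectMul_norm_sub_le hmm
  -- Expanding `B' = G + 18 G n³ + 3228 n³ + 2 n + 1` gives `19 = 1 + 18` and `3231 = 3228 + 2 + 1`.
  -- As `G` has order `n ^ (d + 3)`, `B'` has order `n ^ (d + 6)`, and `2 m - 1 ≤ 2 n` supplies the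
  -- last factor.
  refine ⟨2 * (19 * (27 * D + 37) + 3231), d + 7, by positivity, fun n hn => ?_⟩
  set κ := D * (n : ℝ) ^ d with hκ
  have hκ0 : 0 ≤ κ := by positivity
  obtain ⟨G, hG⟩ : ∃ G, G = 27 * (n : ℝ) ^ 2 * κ + 37 * n ^ 3 := ⟨_, rfl⟩
  obtain ⟨B, hB⟩ : ∃ B, B = 9 * (n : ℝ) ^ 2 * G + 1614 * n ^ 2 + 1 := ⟨_, rfl⟩
  obtain ⟨B', hB'⟩ : ∃ B', B' = G + 2 * n * B + 1 := ⟨_, rfl⟩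
  have hn1 : (1 : ℝ) ≤ n := by exact_mod_cast hn
  have hpow : ∀ i j : ℕ, i ≤ j → (n : ℝ) ^ i ≤ n ^ j := fun i j hij => pow_le_pow_right₀ hn1 hij
  have hG0 : 0 ≤ G := by rw [hG]; positivity
  have hG1 : G ≤ (27 * D + 37) * n ^ (d + 3) := by
    have h1 := mul_le_mul_of_nonneg_left (hpow (d + 2) (d + 3) (by omega)) hD
    have h2 := hpow 3 (d + 3) (by omega)
    rw [hG, hκ]
    rw [pow_add _ d 2] at h1
    linarith
  have hBB' : B ≤ B' := by
    rw [hB']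
    have : 0 ≤ B := by rw [hB]; positivity
    nlinarith
  have hB'1 : B' ≤ (19 * (27 * D + 37) + 3231) * n ^ (d + 6) := by
    have h1 : 0 ≤ (27 * D + 37) := by positivity
    have h2 : G * n ^ 3 ≤ (27 * D + 37) * n ^ (d + 6) := by
      refine (mul_le_mul_of_nonneg_right hG1 (by positivity)).trans (le_of_eq ?_)
      ring
    have h3 : G ≤ G * n ^ 3 := le_mul_of_one_le_right hG0 (one_le_pow₀ hn1)
    have h4 := hpow 3 (d + 6) (by omega)
    have h5 : (n : ℝ) ≤ n ^ (d + 6) := by simpa using hpow 1 (d + 6) (by omega)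
    have h6 : (1 : ℝ) ≤ n ^ (d + 6) := one_le_pow₀ hn1
    have e : B' = G + 18 * (G * n ^ 3) + 3228 * n ^ 3 + 2 * n + 1 := by
      rw [hB', hB]
      ring
    linarith
  filter_upwards [hrect n hn, eventually_pos, eventually_mul_le_one κ,
    eventually_mul_le_one (4 * n ^ 2 * B ^ 2), eventually_mul_le_one (2 * n * B' ^ 2),
    eventually_mul_le_one (6 * n ^ 2 * B + 3 * n * G),
    eventually_mul_le_one (1000 * n * (2 * n + 4))]
    with ε hmm hε s₁ s₂ s₃ s₄ s₅ m hm h A R W Y t hex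
  have hB'ε : 0 ≤ B' * ε := by
    have : 0 ≤ B' := le_trans (by rw [hB]; positivity) hBB'
    positivity
  have hmn : (m : ℝ) ≤ n := by exact_mod_cast h
  have hm1 : (1 : ℝ) ≤ m := by exact_mod_cast hm
  have hfin : (2 * (m : ℝ) - 1) * (B' * ε) ≤
      2 * (19 * (27 * D + 37) + 3231) * n ^ (d + 7) * ε := by
    calc (2 * (m : ℝ) - 1) * (B' * ε) ≤ 2 * n * (B' * ε) :=
          mul_le_mul_of_nonneg_right (by linarith) hB'ε
      _ = 2 * n * ε * B' := by ring
      _ ≤ 2 * n * ε * ((19 * (27 * D + 37) + 3231) * n ^ (d + 6)) :=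
          mul_le_mul_of_nonneg_left hB'1 (by positivity)
      _ = _ := by ring
  refine (isApproxQR_of_exec hn hε hκ0 hmm hG hB hB' s₁ s₂ s₃ s₄ s₅ m n hm h le_rfl A R W Y t
    hex).mono ?_ hfin
  refine le_trans ?_ hfin
  exact mul_le_mul_of_nonneg_left (mul_le_mul_of_nonneg_right hBB' hε.le) (by linarith)

theorem qrr_backward_stable {mm : MatMul} (hmm : mm.IsStable) :
    ∃ (K : ℝ) (c : ℕ), ∀ (n m : ℕ) (h : m ≤ n), ∃ ε₀ : ℝ, 0 < ε₀ ∧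
      ∀ ε : ℝ, 0 < ε → ε ≤ ε₀ →
      ∀ (A : Matrix (Fin n) (Fin m) ℝ) (R : Matrix (Fin m) (Fin m) ℝ)
        (W : Matrix (Fin n) (Fin m) ℝ) (Y : Matrix (Fin m) (Fin n) ℝ) (t : ℕ),
        (qrr mm n m h A).Exec ε (R, W, Y) t →
          (∀ i j, j < i → R i j = 0) ∧
          ∃ (δQT : Matrix (Fin n) (Fin n) ℝ) (δA : Matrix (Fin n) (Fin m) ℝ),
            1 - W * Y + δQT ∈ Matrix.orthogonalGroup (Fin n) ℝ ∧
            (1 - W * Y + δQT) * (A + δA) = vcat R 0 ∧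
            ‖δQT‖ ≤ K * (n : ℝ) ^ c * ε ∧
            ‖δA‖ ≤ K * (n : ℝ) ^ c * ε * ‖A‖ := by
  obtain ⟨K, c, hK, hstab⟩ := eventually_isApproxQR hmm
  refine ⟨K, c, fun n m h => ?_⟩
  rcases Nat.eq_zero_or_pos m with rfl | hm
  · refine ⟨1, one_pos, fun ε hε _ A R W Y t _ => ⟨fun i => i.elim0, 0, 0, ?_, ?_, ?_, ?_⟩⟩
    · have : W * Y = 0 := by
        ext i j
        simp [Matrix.mul_apply]
      rw [this, sub_zero, add_zero]
      exact one_mem _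
    · ext i j
      exact j.elim0
    · rw [norm_zero]
      positivity
    · rw [norm_zero]
      positivity
  · obtain ⟨ε₀, hε₀, hsub⟩ := mem_nhdsGT_iff_exists_Ioc_subset.1 (hstab n (by omega))
    refine ⟨ε₀, hε₀, fun ε hε hεε₀ A R W Y t hex => ?_⟩
    obtain ⟨hR, -, -, Q, δA, hQ, hQW, hQA, hδA⟩ := hsub ⟨hε, hεε₀⟩ m hm h A R W Y t hex
    refine ⟨hR, Q - (1 - W * Y), δA, ?_, ?_, hQW, hδA⟩
    · rwa [add_sub_cancel]
    · rwa [add_sub_cancel]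

end StabilityOfQRR

/-! ### Operation counts -/

section Cost

/-- The actual count is at most `6 n + 6`; `0 < n` turns it into a multiple of `n`. -/
theorem exec_householder_cost {n : ℕ} (hn : 0 < n) {x : Fin n → ℝ} {ε : ℝ}
    {o : ℝ × (Fin n → ℝ) × (Fin n → ℝ)} {t : ℕ} (h : (householder hn x).Exec ε o t) :
    t ≤ 12 * n := by
  simp only [householder, exec_bind, exec_literal] at h
  obtain ⟨_, _, _, ⟨rfl, rfl⟩, ⟨_, _, _, ⟨rfl, rfl⟩, ⟨_, _, _, ⟨rfl, rfl⟩,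
    ⟨σ, s₁, u₁, hσ, ⟨nz, s₂, u₂, hnz, h, rfl⟩, rfl⟩, rfl⟩, rfl⟩, rfl⟩ := h
  obtain ⟨-, rfl⟩ := exec_vecLength hσ
  obtain ⟨-, rfl⟩ := exec_isLess.1 hnz
  suffices u₂ ≤ 4 * n + 4 by omega
  cases nz
  · simp only [Bool.false_eq_true, if_false, exec_pure] at h
    omega
  simp only [if_true, exec_bind] at h
  obtain ⟨neg, s₃, u₃, hneg, h, rfl⟩ := h
  obtain ⟨-, rfl⟩ := exec_isLess.1 hneg
  obtain ⟨ρ, s₄, u₄, hs₄, h', rfl⟩ : ∃ ρ s u, s ≤ 1 ∧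
      (do
        let v₁ ← fsub (x ⟨0, hn⟩) ρ
        let τ ← vecLength fun i => if i = ⟨0, hn⟩ then v₁ else x i
        let w ← tabulate fun i => fdiv (if i = ⟨0, hn⟩ then v₁ else x i) τ
        let y ← tabulate fun i => fmul 2 (w i)
        pure (ρ, w, y) : Prog ℝ _).Exec ε o u ∧ u₃ = s + u := by
    cases neg
    · simp only [Bool.false_eq_true, if_false] at h
      rw [exec_bind] at h
      obtain ⟨ρ, s, u, hρ, h, rfl⟩ := h
      exact ⟨ρ, s, u, (exec_fsub.1 hρ).2.le, h, rfl⟩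
    · simp only [if_true] at h
      rw [exec_bind] at h
      obtain ⟨ρ, s, u, hρ, h, rfl⟩ := h
      exact ⟨ρ, s, u, by rw [(exec_pure.1 hρ).2]; exact zero_le_one, h, rfl⟩
  simp only [exec_bind] at h'
  obtain ⟨v₁, s₅, u₅, hv₁, ⟨τ, s₆, u₆, hτ, ⟨w, s₇, u₇, hw, ⟨y, s₈, u₈, hy, hp, rfl⟩, rfl⟩, rfl⟩,
    rfl⟩ := h'
  obtain ⟨-, rfl⟩ := exec_fsub.1 hv₁
  obtain ⟨-, rfl⟩ := exec_vecLength hτ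
  obtain ⟨ts, hts, rfl⟩ := hw.tabulate
  obtain ⟨us, hus, rfl⟩ := hy.tabulate
  obtain ⟨-, rfl⟩ := exec_pure.1 hp
  simp only [exec_fdiv] at hts
  simp only [exec_fmul] at hus
  have h1 := sum_le_of_forall_le fun i => (hts i).2.le
  have h2 := sum_le_of_forall_le fun i => (hus i).2.le
  omega

theorem exec_blockSum_cost {mm : MatMul} {k b : ℕ} {ε c : ℝ}
    (hmm : ∀ (A B P : Matrix (Fin k) (Fin k) ℝ) (t : ℕ), (mm ℝ k A B).Exec ε P t → (t : ℝ) ≤ c)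
    {X Y : ℕ → Matrix (Fin k) (Fin k) ℝ} {S : Matrix (Fin k) (Fin k) ℝ} {t : ℕ}
    (h : (blockSum mm b 0 X Y).Exec ε S t) : (t : ℝ) ≤ b * (c + k ^ 2) := by
  have key := Exec.foldlM (fun l _ t => (t : ℝ) ≤ l.length * (c + k ^ 2)) ?_ (by simp) h
  · rwa [List.length_range] at key
  · intro l K S S' s u hs hS'
    simp only [exec_bind] at hS'
    obtain ⟨P, s₁, s₂, hP, hS', rfl⟩ := hS'
    obtain ⟨-, rfl⟩ := exec_matAdd hS'
    have := hmm _ _ _ _ hP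
    simp only [List.length_append, List.length_singleton]
    push_cast
    linarith

theorem cast_ceilDiv_le {p k : ℕ} (hk : 0 < k) (hkp : k ≤ p) :
    (((p + k - 1) / k : ℕ) : ℝ) ≤ 2 * p / k := by
  refine Nat.cast_div_le.trans ?_
  have : ((p + k - 1 : ℕ) : ℝ) ≤ 2 * p := by exact_mod_cast (by omega : p + k - 1 ≤ 2 * p)
  gcongr

/-- Rounding up at most doubles the number of blocks in each direction, hence the `8`. Adding a
block product to the accumulator costs `k² ≤ k ^ γ`, hence `C + 1`. -/
theorem exec_rectMul_cost {mm : MatMul} {p q r k : ℕ} {C γ ε : ℝ} (hγ : 2 ≤ γ) (hC : 0 ≤ C)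
    (hk : k = min p (min q r)) (hk0 : 0 < k)
    (hmm : ∀ (A B P : Matrix (Fin k) (Fin k) ℝ) (t : ℕ), (mm ℝ k A B).Exec ε P t →
      (t : ℝ) ≤ C * (k : ℝ) ^ γ)
    {A : Matrix (Fin p) (Fin q) ℝ} {B : Matrix (Fin q) (Fin r) ℝ} {P : Matrix (Fin p) (Fin r) ℝ}
    {t : ℕ} (h : (rectMul mm A B).Exec ε P t) :
    (t : ℝ) ≤ 8 * (C + 1) * ((p * q * r : ℕ) : ℝ) * (k : ℝ) ^ (γ - 3) := by
  obtain ⟨S, ts, hts, -, rfl⟩ := exec_rectMul hk hk0 h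
  have hkr : (0 : ℝ) < k := by exact_mod_cast hk0
  have hk1 : (1 : ℝ) ≤ k := by exact_mod_cast hk0
  have hkγ : (k : ℝ) ^ 2 ≤ (k : ℝ) ^ γ := by
    rw [← Real.rpow_natCast]
    exact Real.rpow_le_rpow_of_exponent_le hk1 (by exact_mod_cast hγ)
  have hblock : ∀ I J, (ts I J : ℝ) ≤ (2 * q / k) * ((C + 1) * (k : ℝ) ^ γ) := fun I J => by
    refine (exec_blockSum_cost hmm (hts I J)).trans ?_
    exact mul_le_mul (cast_ceilDiv_le hk0 (by omega)) (by linarith) (by positivity) (by positivity)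
  push_cast
  calc ∑ I, ∑ J, (ts I J : ℝ)
      ≤ ∑ _I : Fin ((p + k - 1) / k), ∑ _J : Fin ((r + k - 1) / k),
          (2 * q / k) * ((C + 1) * (k : ℝ) ^ γ) :=
        Finset.sum_le_sum fun I _ => Finset.sum_le_sum fun J _ => hblock I J
    _ = (((p + k - 1) / k : ℕ) : ℝ) * ((((r + k - 1) / k : ℕ) : ℝ) *
          ((2 * q / k) * ((C + 1) * (k : ℝ) ^ γ))) := by simp
    _ ≤ (2 * p / k) * ((2 * r / k) * ((2 * q / k) * ((C + 1) * (k : ℝ) ^ γ))) := by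
        have h1 := cast_ceilDiv_le (p := p) hk0 (by omega)
        have h2 := cast_ceilDiv_le (p := r) hk0 (by omega)
        gcongr
    _ = 8 * (C + 1) * (p * q * r) * (k : ℝ) ^ (γ - 3) := by
        have : (k : ℝ) ^ (γ - 3) = (k : ℝ) ^ γ / k ^ 3 := by
          rw [Real.rpow_sub hkr]
          norm_cast
        rw [this]
        field_simp
        ring

/-- Cost of a rectangular multiplication in the recursion for an `n`-by-`m` matrix. -/
theorem exec_rectMul_cost_le {mm : MatMul} {p q r l n m : ℕ} {C γ ε : ℝ} (hγ : 2 < γ)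
    (hC : 0 ≤ C) (hl : l = min p (min q r)) (hl0 : 0 < l) (hlm : l ≤ m)
    (hpqr : p * q * r ≤ n * l * m)
    (hmm : ∀ (A B P : Matrix (Fin l) (Fin l) ℝ) (t : ℕ), (mm ℝ l A B).Exec ε P t →
      (t : ℝ) ≤ C * (l : ℝ) ^ γ)
    {A : Matrix (Fin p) (Fin q) ℝ} {B : Matrix (Fin q) (Fin r) ℝ} {P : Matrix (Fin p) (Fin r) ℝ}
    {t : ℕ} (h : (rectMul mm A B).Exec ε P t) :
    (t : ℝ) ≤ 8 * (C + 1) * (n * (m : ℝ) ^ (γ - 1)) := by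
  have hl' : (0 : ℝ) < l := by exact_mod_cast hl0
  have hm' : (0 : ℝ) < m := by exact_mod_cast hl0.trans_le hlm
  have h1 : ((p * q * r : ℕ) : ℝ) ≤ ((n * l * m : ℕ) : ℝ) := by exact_mod_cast hpqr
  -- The exponent `γ - 3` may be negative, so one factor `l` of the volume is combined with it
  -- before `l ≤ m` is used; `γ > 2` makes the resulting power monotone.
  have h2 : (l : ℝ) * (l : ℝ) ^ (γ - 3) = (l : ℝ) ^ (γ - 2) := by
    rw [← Real.rpow_one_add' hl'.le (by linarith)]
    congr 1
    ring
  have h3 : (m : ℝ) * (m : ℝ) ^ (γ - 2) = (m : ℝ) ^ (γ - 1) := by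
    rw [← Real.rpow_one_add' hm'.le (by linarith)]
    congr 1
    ring
  have h4 : (l : ℝ) ^ (γ - 2) ≤ (m : ℝ) ^ (γ - 2) :=
    Real.rpow_le_rpow hl'.le (by exact_mod_cast hlm) (by linarith)
  refine (exec_rectMul_cost hγ.le hC hl hl0 hmm h).trans ?_
  calc 8 * (C + 1) * ((p * q * r : ℕ) : ℝ) * (l : ℝ) ^ (γ - 3)
      ≤ 8 * (C + 1) * ((n * l * m : ℕ) : ℝ) * (l : ℝ) ^ (γ - 3) := by gcongr
    _ = 8 * (C + 1) * (n * (m * (l * (l : ℝ) ^ (γ - 3)))) := by push_cast; ring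
    _ = 8 * (C + 1) * (n * (m * (l : ℝ) ^ (γ - 2))) := by rw [h2]
    _ ≤ 8 * (C + 1) * (n * (m * (m : ℝ) ^ (γ - 2))) := by gcongr
    _ = _ := by rw [h3]

/-- Halving decreases the sum of the `g`-th powers by a constant factor. -/
theorem rpow_add_rpow_le {a b s g : ℝ} (hg : 1 < g) (ha : 0 < a) (hb : 0 < b) (hab : a + b = s)
    (ha' : a ≤ 2 / 3 * s) (hb' : b ≤ 2 / 3 * s) :
    a ^ g + b ^ g ≤ (2 / 3 : ℝ) ^ (g - 1) * s ^ g := by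
  have hs : 0 < s := by linarith
  have e : ∀ x : ℝ, 0 < x → x ^ g = x * x ^ (g - 1) := fun x hx => by
    rw [← Real.rpow_one_add' hx.le (by linarith)]
    congr 1
    ring
  have h1 : a ^ (g - 1) ≤ (2 / 3 * s) ^ (g - 1) := Real.rpow_le_rpow ha.le ha' (by linarith)
  have h2 : b ^ (g - 1) ≤ (2 / 3 * s) ^ (g - 1) := Real.rpow_le_rpow hb.le hb' (by linarith)
  calc a ^ g + b ^ g = a * a ^ (g - 1) + b * b ^ (g - 1) := by rw [e a ha, e b hb]
    _ ≤ a * (2 / 3 * s) ^ (g - 1) + b * (2 / 3 * s) ^ (g - 1) := by gcongr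
    _ = s * (2 / 3 * s) ^ (g - 1) := by rw [← add_mul, hab]
    _ = _ := by
        rw [Real.mul_rpow (by norm_num) hs.le, e s hs]
        ring

/-- The local work is four products, each within `8 (C + 1) n m ^ (γ - 1)`, and two subtractions.
The halves leave the fraction `1 - (2/3) ^ (γ - 2)` of the budget `K n m ^ (γ - 1)` for it, which is
`hKC`; `hK` pays for the single columns. -/
theorem exec_qrr_cost {mm : MatMul} {C K γ ε : ℝ} (hγ : 2 < γ) (hC : 0 ≤ C)
    (hmm : ∀ k : ℕ, 1 ≤ k → ∀ (A B P : Matrix (Fin k) (Fin k) ℝ) (t : ℕ),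
      (mm ℝ k A B).Exec ε P t → (t : ℝ) ≤ C * (k : ℝ) ^ γ)
    (hK : 12 ≤ K) (hKC : 32 * (C + 1) + 2 ≤ K * (1 - (2 / 3 : ℝ) ^ (γ - 2)))
    (n m : ℕ) (h : m ≤ n) (A : Matrix (Fin n) (Fin m) ℝ) (R : Matrix (Fin m) (Fin m) ℝ)
    (W : Matrix (Fin n) (Fin m) ℝ) (Y : Matrix (Fin m) (Fin n) ℝ) (t : ℕ)
    (hex : (qrr mm n m h A).Exec ε (R, W, Y) t) : (t : ℝ) ≤ K * n * (m : ℝ) ^ (γ - 1) := by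
  induction m using Nat.strong_induction_on generalizing n t with
  | _ m ih =>
  match m with
  | 0 =>
    rw [exec_qrr_zero hex]
    push_cast
    positivity
  | 1 =>
    obtain ⟨ρ, w, y, hex', -⟩ := exec_qrr_one hex
    have h1 : (t : ℝ) ≤ 12 * n := by exact_mod_cast exec_householder_cost h hex'
    rw [Nat.cast_one, Real.one_rpow, mul_one]
    exact h1.trans (mul_le_mul_of_nonneg_right hK (Nat.cast_nonneg _))
  | m + 2 =>
    obtain ⟨l, hl⟩ : ∃ l, l = (m + 2) / 2 := ⟨_, rfl⟩
    have hlm : l ≤ m + 2 := by omega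
    have hln : l ≤ n := hlm.trans h
    have hlmn : m + 2 - l ≤ n - l := by omega
    have hl0 : 0 < l := by omega
    obtain ⟨RL, WL, YL, YA, WYA, AR, RR, WR, YR, YW, WYW, XB, t₁, t₂, t₃, t₄, t₅, t₆, t₇, t₈, h₁,
      h₂, h₃, h₄, h₅, h₆, h₇, h₈, -, -, -, rfl⟩ := exec_qrr_add_two hl hlm hln hlmn hex
    have c₁ := ih l (by omega) n hln _ _ _ _ _ h₁
    have c₅ := ih (m + 2 - l) (by omega) (n - l) hlmn _ _ _ _ _ h₅
    obtain ⟨r, hr⟩ : ∃ r, r = m + 2 - l := ⟨_, rfl⟩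
    have hrm : r ≤ m + 2 := by omega
    have hpqr : ∀ n', n' ≤ n → n' * l * r ≤ n * l * (m + 2) := fun n' hn' =>
      Nat.mul_le_mul (Nat.mul_le_mul_right l hn') hrm
    have hpqr' : (n - l) * l * r ≤ n * l * (m + 2) := hpqr (n - l) (Nat.sub_le _ _)
    have d₂ : l * n * (m + 2 - l) ≤ n * l * (m + 2) := by
      rw [← hr, Nat.mul_comm l n]
      exact hpqr n le_rfl
    have d₃ : n * l * (m + 2 - l) ≤ n * l * (m + 2) := by
      rw [← hr]
      exact hpqr n le_rfl
    have d₆ : (m + 2 - l) * (n - l) * l ≤ n * l * (m + 2) := by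
      rw [← hr]
      exact (by ring : r * (n - l) * l = (n - l) * l * r).trans_le hpqr'
    have d₇ : (n - l) * (m + 2 - l) * l ≤ n * l * (m + 2) := by
      rw [← hr]
      exact (by ring : (n - l) * r * l = (n - l) * l * r).trans_le hpqr'
    -- In all four products `l` is the least dimension: `l ≤ m + 2 - l ≤ n - l` because `l` is
    -- rounded down.
    have c₂ := exec_rectMul_cost_le hγ hC (by omega) hl0 hlm d₂ (hmm l hl0) h₂
    have c₃ := exec_rectMul_cost_le hγ hC (by omega) hl0 hlm d₃ (hmm l hl0) h₃
    have c₆ := exec_rectMul_cost_le hγ hC (by omega) hl0 hlm d₆ (hmm l hl0) h₆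
    have c₇ := exec_rectMul_cost_le hγ hC (by omega) hl0 hlm d₇ (hmm l hl0) h₇
    have hs1 : (1 : ℝ) ≤ ((m + 2 : ℕ) : ℝ) := by exact_mod_cast (by omega : 1 ≤ m + 2)
    have hsg : ((m + 2 : ℕ) : ℝ) ≤ ((m + 2 : ℕ) : ℝ) ^ (γ - 1) :=
      Real.self_le_rpow_of_one_le hs1 (by linarith)
    have csub : ∀ a b : ℕ, a ≤ n → b ≤ m + 2 →
        ((a * b : ℕ) : ℝ) ≤ n * ((m + 2 : ℕ) : ℝ) ^ (γ - 1) := fun a b ha hb => by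
      have : ((a * b : ℕ) : ℝ) ≤ ((n * (m + 2) : ℕ) : ℝ) := by exact_mod_cast Nat.mul_le_mul ha hb
      refine this.trans ?_
      rw [Nat.cast_mul]
      exact mul_le_mul_of_nonneg_left hsg (Nat.cast_nonneg _)
    have c₄ : (t₄ : ℝ) ≤ n * ((m + 2 : ℕ) : ℝ) ^ (γ - 1) := by
      rw [(exec_matSub h₄).2]
      exact csub _ _ le_rfl (Nat.sub_le _ _)
    have c₈ : (t₈ : ℝ) ≤ n * ((m + 2 : ℕ) : ℝ) ^ (γ - 1) := by
      rw [(exec_matSub h₈).2]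
      exact csub _ _ (Nat.sub_le _ _) hlm
    rw [← hr] at c₅
    have c₅' : (t₅ : ℝ) ≤ K * n * (r : ℝ) ^ (γ - 1) := by
      refine c₅.trans ?_
      have : ((n - l : ℕ) : ℝ) ≤ n := by exact_mod_cast Nat.sub_le _ _
      gcongr
    -- The larger part is at most two thirds of the whole, with equality for three columns split as
    -- `1 + 2`; hence the ratio `2 / 3` in place of `1 / 2`.
    have hpow := rpow_add_rpow_le (a := l) (b := r) (s := ((m + 2 : ℕ) : ℝ)) (g := γ - 1)
      (by linarith) (by exact_mod_cast hl0) (by exact_mod_cast (by omega : 0 < r))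
      (by exact_mod_cast (by omega : l + r = m + 2))
      (by
        have : 3 * l ≤ 2 * (m + 2) := by omega
        have : (3 * l : ℝ) ≤ 2 * (m + 2 : ℕ) := by exact_mod_cast this
        linarith)
      (by
        have : 3 * r ≤ 2 * (m + 2) := by omega
        have : (3 * r : ℝ) ≤ 2 * (m + 2 : ℕ) := by exact_mod_cast this
        linarith)
    rw [show γ - 1 - 1 = γ - 2 by ring] at hpow
    set M := ((m + 2 : ℕ) : ℝ) ^ (γ - 1) with hM
    have hM0 : 0 ≤ M := by positivity
    have hn0 : (0 : ℝ) ≤ n := Nat.cast_nonneg _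
    have h6 := mul_le_mul_of_nonneg_left hpow (by positivity : 0 ≤ K * n)
    have h7 := mul_le_mul_of_nonneg_right hKC (by positivity : 0 ≤ n * M)
    push_cast
    linarith

theorem qrr_cost {mm : MatMul} {γ : ℝ} (hγ : 2 < γ) (hmm : mm.HasCost γ) :
    ∃ C : ℝ, ∀ (n m : ℕ) (h : m ≤ n) (ε : ℝ), 0 ≤ ε → ε < 1 →
      ∀ (A : Matrix (Fin n) (Fin m) ℝ) (R : Matrix (Fin m) (Fin m) ℝ)
        (W : Matrix (Fin n) (Fin m) ℝ) (Y : Matrix (Fin m) (Fin n) ℝ) (t : ℕ),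
        (qrr mm n m h A).Exec ε (R, W, Y) t →
          (t : ℝ) ≤ C * n * (m : ℝ) ^ (γ - 1) := by
  obtain ⟨C, hC⟩ := hmm
  have hθ : (2 / 3 : ℝ) ^ (γ - 2) < 1 :=
    Real.rpow_lt_one (by norm_num) (by norm_num) (by linarith)
  have hθ' : 0 < 1 - (2 / 3 : ℝ) ^ (γ - 2) := by linarith
  have hpos : 0 ≤ (32 * (|C| + 1) + 2) / (1 - (2 / 3 : ℝ) ^ (γ - 2)) := by positivity
  refine ⟨12 + (32 * (|C| + 1) + 2) / (1 - (2 / 3 : ℝ) ^ (γ - 2)),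
    fun n m h ε hε hε1 A R W Y t hex => ?_⟩
  refine exec_qrr_cost hγ (abs_nonneg C) (fun k hk A B P t hP => ?_) (by linarith) ?_ n m h A R W Y
    t hex
  · exact (hC k hk ε hε hε1 A B P t hP).trans
      (mul_le_mul_of_nonneg_right (le_abs_self C) (by positivity))
  · rw [add_mul, div_mul_cancel₀ _ hθ'.ne']
    linarith

end Cost

theorem mainTheorem2 (mm : MatMul) :
    (∀ γ : ℝ, 2 < γ → mm.HasCost γ →
      ∃ C : ℝ, ∀ (n m : ℕ) (h : m ≤ n) (ε : ℝ), 0 ≤ ε → ε < 1 →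
        ∀ (A : Matrix (Fin n) (Fin m) ℝ) (R : Matrix (Fin m) (Fin m) ℝ)
          (W : Matrix (Fin n) (Fin m) ℝ) (Y : Matrix (Fin m) (Fin n) ℝ) (t : ℕ),
          (qrr mm n m h A).Exec ε (R, W, Y) t →
            (t : ℝ) ≤ C * n * (m : ℝ) ^ (γ - 1)) ∧
    (mm.IsStable →
      ∃ (K : ℝ) (c : ℕ), ∀ (n m : ℕ) (h : m ≤ n), ∃ ε₀ : ℝ, 0 < ε₀ ∧
        ∀ ε : ℝ, 0 < ε → ε ≤ ε₀ →
        ∀ (A : Matrix (Fin n) (Fin m) ℝ) (R : Matrix (Fin m) (Fin m) ℝ)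
          (W : Matrix (Fin n) (Fin m) ℝ) (Y : Matrix (Fin m) (Fin n) ℝ) (t : ℕ),
          (qrr mm n m h A).Exec ε (R, W, Y) t →
            (∀ i j, j < i → R i j = 0) ∧
            ∃ (δQT : Matrix (Fin n) (Fin n) ℝ) (δA : Matrix (Fin n) (Fin m) ℝ),
              1 - W * Y + δQT ∈ Matrix.orthogonalGroup (Fin n) ℝ ∧
              (1 - W * Y + δQT) * (A + δA) = vcat R 0 ∧
              ‖δQT‖ ≤ K * (n : ℝ) ^ c * ε ∧
              ‖δA‖ ≤ K * (n : ℝ) ^ c * ε * ‖A‖) :=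
  ⟨fun _ hγ hmm => qrr_cost hγ hmm, fun hmm => qrr_backward_stable hmm⟩
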